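/- All algebra is over $\mathbb{Q}$ and gradings are over $\mathbb{Z}$. A DGL is a differential graded Lie algebra with differential $\partial$ of degree $-1$; it is formal if a finite zig-zag of DGL quasi-isomorphisms joins it to its homology $H_*(L)$, with the induced bracket and zero differential. Let $k\ge 2$ and $n_1,\dots,n_k\in\mathbb{Z}$. Let $\mathbb{L}(U)$ be the DGL whose underlying graded Lie algebra is free on generators $u_I$, for $\emptyset\ne I\subsetneq\{1,\dots,k\}$, of degree $|u_I|=\sum_{i\in I}n_i-1$, with $$\partial u_I=\sum_{J}\varepsilon(J,I\setminus J)\,(-1)^{|u_J|}\,[u_J,u_{I\setminus J}],$$ where $J$ runs over the proper subsets of $I$ that contain $\min I$, and $\varepsilon(J,K)=\prod_{j\in J,\,i\in K,\,i<j}(-1)^{n_jn_i}$ is the Koszul sign. Let $w\in\mathbb{L}(U)$, of degree $n_1+\dots+n_k-2$, be the cycle given by the same formula for $I=\{1,\dots,k\}$. For a DGL $L$, classes $x_i\in H_{n_i-1}(L)$ and cycles $a_i\in L$ representing $x_i$ ($1\le i\le k$), the $k$-th order Whitehead bracket set is $$[x_1,\dots,x_k]=\{\overline{\phi(w)}\mid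 \phi:\mathbb{L}(U)\to L \text{ a DGL morphism with } \phi(u_{\{i\}})=a_i \text{ for all } i\}\subseteq H_{n_1+\dots+n_k-2}(L).$$ Theorem. Let $L$ be a DGL, $k\ge2$, $x_i\in H_{n_i-1}(L)$ for $1\le i\le k$, and suppose that, for some choice of cycles $a_i$ representing the $x_i$, the set $[x_1,\dots,x_k]$ (computed with this choice) is non-empty. Let $[x_1,\dots,x_k]'$ be the Whitehead bracket set of $x_1,\dots,x_k$ computed in the DGL $H=H_*(L)$ with zero differential, where each $x_i$ is its own representative. Then $L$ is not formal if one of the following conditions holds: 1. $k\ge3$ and $0\notin[x_1,\dots,x_k]$; 2. the sets $[x_1,\dots,x_k]$ and $[x_1,\dots,x_k]'$ are not in bijection. -/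

import Mathlib

universe u v

/-- A `ℤ`-graded Lie algebra over `ℚ`.  The component of degree `n` is `obj n`.  The bracket takes
the target degree `p` together with a proof of `m + n = p`, so that no casts are needed. -/
structure GradedLie : Type (u + 1) where
  obj : ℤ → Type u
  [addCommGroup : ∀ n, AddCommGroup (obj n)]
  [module : ∀ n, Module ℚ (obj n)]
  bracket : ∀ {m n p : ℤ}, m + n = p → obj m →ₗ[ℚ] obj n →ₗ[ℚ] obj p
  antisymm : ∀ {m n p : ℤ} (h : m + n = p) (x : obj m) (y : obj n),
    bracket h x y = -((-1 : ℚ) ^ (m * n) • bracket ((add_comm n m).trans h) y x)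
  jacobi : ∀ {l m n lm mn ln p : ℤ} (hlm : l + m = lm) (hmn : m + n = mn) (hln : l + n = ln)
    (h₁ : l + mn = p) (h₂ : lm + n = p) (h₃ : m + ln = p) (x : obj l) (y : obj m) (z : obj n),
    bracket h₁ x (bracket hmn y z) =
      bracket h₂ (bracket hlm x y) z + (-1 : ℚ) ^ (l * m) • bracket h₃ y (bracket hln x z)

attribute [instance] GradedLie.addCommGroup GradedLie.module

/-- A differential graded Lie algebra over `ℚ`, graded over `ℤ`, with differential of degree `-1`. -/
structure DGL : Type (u + 1) extends GradedLie.{u} where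
  d : ∀ m n : ℤ, n + 1 = m → obj m →ₗ[ℚ] obj n
  d_d : ∀ {l m n : ℤ} (h : m + 1 = l) (h' : n + 1 = m) (x : obj l), d m n h' (d l m h x) = 0
  leibniz : ∀ {m n p m' n' p' : ℤ} (h : m + n = p) (hm : m' + 1 = m) (hn : n' + 1 = n)
    (hp : p' + 1 = p) (h₁ : m' + n = p') (h₂ : m + n' = p') (x : obj m) (y : obj n),
    d p p' hp (bracket h x y) =
      bracket h₁ (d m m' hm x) y + (-1 : ℚ) ^ m • bracket h₂ x (d n n' hn y)

namespace DGL

/-- Morphisms of DGLs: degree-zero linear maps commuting with brackets and differentials. -/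
structure Hom (A : DGL.{u}) (B : DGL.{v}) where
  map : ∀ n, A.obj n →ₗ[ℚ] B.obj n
  map_bracket : ∀ {m n p : ℤ} (h : m + n = p) (x : A.obj m) (y : A.obj n),
    map p (A.bracket h x y) = B.bracket h (map m x) (map n y)
  map_d : ∀ {m n : ℤ} (h : n + 1 = m) (x : A.obj m), map n (A.d m n h x) = B.d m n h (map m x)

section Homology

/-- Cycles of degree `n`. -/
def cycles (L : DGL.{u}) (n : ℤ) : Submodule ℚ (L.obj n) :=
  LinearMap.ker (L.d n (n - 1) (sub_add_cancel n 1))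

/-- Boundaries of degree `n`. -/
def boundaries (L : DGL.{u}) (n : ℤ) : Submodule ℚ (L.obj n) :=
  LinearMap.range (L.d (n + 1) n rfl)

/-- The homology `H_n(L)`: cycles modulo boundaries. -/
abbrev H (L : DGL.{u}) (n : ℤ) : Type u :=
  L.cycles n ⧸ (L.boundaries n).submoduleOf (L.cycles n)

/-- The homology class of a cycle. -/
def cls (L : DGL.{u}) {n : ℤ} : L.cycles n →ₗ[ℚ] L.H n :=
  Submodule.mkQ _

theorem mem_cycles {L : DGL.{u}} {m : ℤ} (n : ℤ) (h : n + 1 = m) (x : L.obj m) :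
    x ∈ L.cycles m ↔ L.d m n h x = 0 := by
  obtain rfl : n = m - 1 := by omega
  rfl

theorem mem_boundaries {L : DGL.{u}} {n : ℤ} (m : ℤ) (h : n + 1 = m) (x : L.obj n) :
    x ∈ L.boundaries n ↔ ∃ y, L.d m n h y = x := by
  subst h
  rfl

theorem bracket_mem_cycles (L : DGL.{u}) {m n p : ℤ} (h : m + n = p) {x : L.obj m} {y : L.obj n}
    (hx : x ∈ L.cycles m) (hy : y ∈ L.cycles n) : L.bracket h x y ∈ L.cycles p := by
  rw [mem_cycles (p - 1) (by omega)]
  rw [mem_cycles (m - 1) (by omega)] at hx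
  rw [mem_cycles (n - 1) (by omega)] at hy
  rw [L.leibniz h (m' := m - 1) (n' := n - 1) (by omega) (by omega) (by omega) (by omega)
    (by omega), hx, hy]
  simp

theorem bracket_mem_boundaries_right (L : DGL.{u}) {m n p : ℤ} (h : m + n = p) {x : L.obj m}
    {y : L.obj n} (hx : x ∈ L.cycles m) (hy : y ∈ L.boundaries n) :
    L.bracket h x y ∈ L.boundaries p := by
  rw [mem_boundaries (p + 1) rfl]
  rw [mem_boundaries (n + 1) rfl] at hy
  rw [mem_cycles (m - 1) (by omega)] at hx
  obtain ⟨z, rfl⟩ := hy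
  refine ⟨(-1 : ℚ) ^ m • L.bracket (by omega) x z, ?_⟩
  rw [map_smul, L.leibniz (m := m) (n := n + 1) (by omega) (m' := m - 1) (n' := n) (by omega)
    (by omega) (by omega) (by omega) h, hx]
  simp only [map_zero, LinearMap.zero_apply, zero_add, smul_smul]
  rw [← mul_zpow]
  simp

theorem bracket_mem_boundaries_left (L : DGL.{u}) {m n p : ℤ} (h : m + n = p) {x : L.obj m}
    {y : L.obj n} (hx : x ∈ L.boundaries m) (hy : y ∈ L.cycles n) :
    L.bracket h x y ∈ L.boundaries p := by
  rw [L.antisymm]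
  exact neg_mem (Submodule.smul_mem _ _ (L.bracket_mem_boundaries_right _ hy hx))

/-- The bracket of two cycles, as a homology class. -/
def cyclesBracket (L : DGL.{u}) {m n p : ℤ} (h : m + n = p) :
    L.cycles m →ₗ[ℚ] L.cycles n →ₗ[ℚ] L.H p :=
  LinearMap.mk₂ ℚ
    (fun x y => L.cls ⟨L.bracket h x.1 y.1, L.bracket_mem_cycles h x.2 y.2⟩)
    (fun x x' y => by rw [← map_add]; congr 1; ext; simp)
    (fun c x y => by rw [← map_smul]; congr 1; ext; simp)
    (fun x y y' => by rw [← map_add]; congr 1; ext; simp)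
    (fun c x y => by rw [← map_smul]; congr 1; ext; simp)

theorem cls_eq_zero (L : DGL.{u}) {n : ℤ} (x : L.cycles n) :
    L.cls x = 0 ↔ x.1 ∈ L.boundaries n := by
  unfold cls
  rw [Submodule.mkQ_apply, Submodule.Quotient.mk_eq_zero]
  rfl

/-- The bracket induced on homology. -/
def homologyBracket (L : DGL.{u}) {m n p : ℤ} (h : m + n = p) :
    L.H m →ₗ[ℚ] L.H n →ₗ[ℚ] L.H p :=
  Submodule.liftQ _
    (LinearMap.flip (Submodule.liftQ _ (L.cyclesBracket h).flip (by
      intro y hy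
      rw [LinearMap.mem_ker]
      ext x
      exact (L.cls_eq_zero _).2 (L.bracket_mem_boundaries_right h x.2 hy))))
    (by
      intro x hx
      rw [LinearMap.mem_ker]
      ext y
      exact (L.cls_eq_zero _).2 (L.bracket_mem_boundaries_left h hx y.2))

theorem homologyBracket_cls (L : DGL.{u}) {m n p : ℤ} (h : m + n = p) (x : L.cycles m)
    (y : L.cycles n) : L.homologyBracket h (L.cls x) (L.cls y) =
      L.cls ⟨L.bracket h x.1 y.1, L.bracket_mem_cycles h x.2 y.2⟩ := rfl

theorem cls_surjective (L : DGL.{u}) {n : ℤ} (c : L.H n) : ∃ x, L.cls x = c :=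
  Submodule.mkQ_surjective _ c

/-- The homology `H_*(L)`, with the induced bracket and zero differential. -/
def homologyDGL (L : DGL.{u}) : DGL.{u} where
  obj := L.H
  bracket := L.homologyBracket
  antisymm h x y := by
    obtain ⟨x, rfl⟩ := L.cls_surjective x
    obtain ⟨y, rfl⟩ := L.cls_surjective y
    rw [homologyBracket_cls, homologyBracket_cls, ← map_smul, ← map_neg]
    congr 1
    ext
    exact L.antisymm h _ _
  jacobi hlm hmn hln h₁ h₂ h₃ x y z := by
    obtain ⟨x, rfl⟩ := L.cls_surjective x
    obtain ⟨y, rfl⟩ := L.cls_surjective y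
    obtain ⟨z, rfl⟩ := L.cls_surjective z
    simp only [homologyBracket_cls]
    rw [← map_smul, ← map_add]
    congr 1
    ext
    exact L.jacobi hlm hmn hln h₁ h₂ h₃ _ _ _
  d _ _ _ := 0
  d_d _ _ _ := rfl
  leibniz _ _ _ _ _ _ _ _ := by simp

theorem Hom.map_mem_cycles {A : DGL.{u}} {B : DGL.{v}} (f : Hom A B) {n : ℤ} {x : A.obj n}
    (hx : x ∈ A.cycles n) : f.map n x ∈ B.cycles n := by
  rw [mem_cycles (n - 1) (by omega)] at *
  rw [← f.map_d, hx, map_zero]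

/-- The map induced by a morphism on homology. -/
def Hom.mapH {A : DGL.{u}} {B : DGL.{v}} (f : Hom A B) (n : ℤ) : A.H n →ₗ[ℚ] B.H n :=
  Submodule.mapQ _ _ ((f.map n).restrict (fun _ hx => f.map_mem_cycles hx)) (by
    intro x hx
    obtain ⟨y, hy⟩ := (mem_boundaries (n + 1) rfl x.1).1 hx
    exact (mem_boundaries (n + 1) rfl (f.map n x.1)).2
      ⟨f.map (n + 1) y, by rw [← f.map_d, hy]⟩)

/-- Quasi-isomorphisms. -/
def Hom.IsQuasiIso {A : DGL.{u}} {B : DGL.{v}} (f : Hom A B) : Prop :=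
  ∀ n, Function.Bijective (f.mapH n)

/-- `L` is formal if a finite zig-zag of DGL quasi-isomorphisms joins `L` to `H_*(L)` with zero
differential. -/
def IsFormal (L : DGL.{u}) : Prop :=
  Relation.EqvGen (fun A B : DGL.{u} => ∃ f : Hom A B, f.IsQuasiIso) L L.homologyDGL

end Homology

end DGL

namespace FreeLie

/-- Formal expressions of each degree in generators `x : X` of degree `deg x`. -/
inductive Pre (X : Type u) (deg : X → ℤ) : ℤ → Type u
  | of (x : X) {n : ℤ} (h : deg x = n) : Pre X deg n
  | zero {n : ℤ} : Pre X deg n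
  | add {n : ℤ} (a b : Pre X deg n) : Pre X deg n
  | neg {n : ℤ} (a : Pre X deg n) : Pre X deg n
  | smul {n : ℤ} (c : ℚ) (a : Pre X deg n) : Pre X deg n
  | br {m n p : ℤ} (h : m + n = p) (a : Pre X deg m) (b : Pre X deg n) : Pre X deg p

/-- The congruence on formal expressions generated by the axioms of graded Lie algebras. -/
inductive Rel (X : Type u) (deg : X → ℤ) : ∀ {n : ℤ}, Pre X deg n → Pre X deg n → Prop
  | refl {n : ℤ} (a : Pre X deg n) : Rel X deg a a
  | symm {n : ℤ} {a b : Pre X deg n} : Rel X deg a b → Rel X deg b a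
  | trans {n : ℤ} {a b c : Pre X deg n} : Rel X deg a b → Rel X deg b c → Rel X deg a c
  | add_congr {n : ℤ} {a a' b b' : Pre X deg n} :
      Rel X deg a a' → Rel X deg b b' → Rel X deg (.add a b) (.add a' b')
  | neg_congr {n : ℤ} {a a' : Pre X deg n} : Rel X deg a a' → Rel X deg (.neg a) (.neg a')
  | smul_congr {n : ℤ} (c : ℚ) {a a' : Pre X deg n} :
      Rel X deg a a' → Rel X deg (.smul c a) (.smul c a')
  | br_congr {m n p : ℤ} (h : m + n = p) {a a' : Pre X deg m} {b b' : Pre X deg n} :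
      Rel X deg a a' → Rel X deg b b' → Rel X deg (.br h a b) (.br h a' b')
  | add_assoc {n : ℤ} (a b c : Pre X deg n) :
      Rel X deg (.add (.add a b) c) (.add a (.add b c))
  | add_comm {n : ℤ} (a b : Pre X deg n) : Rel X deg (.add a b) (.add b a)
  | zero_add {n : ℤ} (a : Pre X deg n) : Rel X deg (.add .zero a) a
  | neg_add {n : ℤ} (a : Pre X deg n) : Rel X deg (.add (.neg a) a) .zero
  | one_smul {n : ℤ} (a : Pre X deg n) : Rel X deg (.smul 1 a) a
  | mul_smul {n : ℤ} (c c' : ℚ) (a : Pre X deg n) :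
      Rel X deg (.smul (c * c') a) (.smul c (.smul c' a))
  | smul_add {n : ℤ} (c : ℚ) (a b : Pre X deg n) :
      Rel X deg (.smul c (.add a b)) (.add (.smul c a) (.smul c b))
  | add_smul {n : ℤ} (c c' : ℚ) (a : Pre X deg n) :
      Rel X deg (.smul (c + c') a) (.add (.smul c a) (.smul c' a))
  | br_add_left {m n p : ℤ} (h : m + n = p) (a a' : Pre X deg m) (b : Pre X deg n) :
      Rel X deg (.br h (.add a a') b) (.add (.br h a b) (.br h a' b))
  | br_smul_left {m n p : ℤ} (h : m + n = p) (c : ℚ) (a : Pre X deg m) (b : Pre X deg n) :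
      Rel X deg (.br h (.smul c a) b) (.smul c (.br h a b))
  | br_add_right {m n p : ℤ} (h : m + n = p) (a : Pre X deg m) (b b' : Pre X deg n) :
      Rel X deg (.br h a (.add b b')) (.add (.br h a b) (.br h a b'))
  | br_smul_right {m n p : ℤ} (h : m + n = p) (c : ℚ) (a : Pre X deg m) (b : Pre X deg n) :
      Rel X deg (.br h a (.smul c b)) (.smul c (.br h a b))
  | antisymm {m n p : ℤ} (h : m + n = p) (h' : n + m = p) (a : Pre X deg m) (b : Pre X deg n) :
      Rel X deg (.br h a b) (.neg (.smul ((-1 : ℚ) ^ (m * n)) (.br h' b a)))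
  | jacobi {l m n lm mn ln p : ℤ} (hlm : l + m = lm) (hmn : m + n = mn) (hln : l + n = ln)
      (h₁ : l + mn = p) (h₂ : lm + n = p) (h₃ : m + ln = p)
      (a : Pre X deg l) (b : Pre X deg m) (c : Pre X deg n) :
      Rel X deg (.br h₁ a (.br hmn b c))
        (.add (.br h₂ (.br hlm a b) c)
          (.smul ((-1 : ℚ) ^ (l * m)) (.br h₃ b (.br hln a c))))

variable {X : Type u} {deg : X → ℤ}

instance preSetoid (X : Type u) (deg : X → ℤ) (n : ℤ) : Setoid (Pre X deg n) where
  r := Rel X deg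
  iseqv := ⟨Rel.refl, Rel.symm, Rel.trans⟩

/-- The degree `n` component of the free graded Lie algebra. -/
def Obj (X : Type u) (deg : X → ℤ) (n : ℤ) : Type u := Quotient (preSetoid X deg n)

/-- The class of a formal expression. -/
def mk {n : ℤ} (a : Pre X deg n) : Obj X deg n := Quotient.mk _ a

theorem mk_surjective {n : ℤ} (x : Obj X deg n) : ∃ a, mk a = x := Quotient.exists_rep x

theorem mk_eq {n : ℤ} {a b : Pre X deg n} (h : Rel X deg a b) : mk a = mk b := Quotient.sound h

instance (n : ℤ) : Zero (Obj X deg n) := ⟨mk .zero⟩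

instance (n : ℤ) : Add (Obj X deg n) :=
  ⟨Quotient.map₂ .add (fun _ _ h _ _ h' => .add_congr h h')⟩

instance (n : ℤ) : Neg (Obj X deg n) := ⟨Quotient.map .neg (fun _ _ h => .neg_congr h)⟩

instance (n : ℤ) : AddCommGroup (Obj X deg n) where
  add_assoc := by rintro ⟨a⟩ ⟨b⟩ ⟨c⟩; exact mk_eq (.add_assoc a b c)
  add_comm := by rintro ⟨a⟩ ⟨b⟩; exact mk_eq (.add_comm a b)
  zero_add := by rintro ⟨a⟩; exact mk_eq (.zero_add a)
  add_zero := by rintro ⟨a⟩; exact mk_eq (.trans (.add_comm _ _) (.zero_add a))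
  neg_add_cancel := by rintro ⟨a⟩; exact mk_eq (.neg_add a)
  nsmul := nsmulRec
  zsmul := zsmulRec

instance (n : ℤ) : SMul ℚ (Obj X deg n) where
  smul c := Quotient.map (.smul c) (fun _ _ h => .smul_congr c h)

instance (n : ℤ) : Module ℚ (Obj X deg n) :=
  Module.ofMinimalAxioms
    (by rintro c ⟨a⟩ ⟨b⟩; exact mk_eq (.smul_add c a b))
    (by rintro c c' ⟨a⟩; exact mk_eq (.add_smul c c' a))
    (by rintro c c' ⟨a⟩; exact mk_eq (.mul_smul c c' a))
    (by rintro ⟨a⟩; exact mk_eq (.one_smul a))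

/-- The bracket of the free graded Lie algebra. -/
def brk {m n p : ℤ} (h : m + n = p) : Obj X deg m →ₗ[ℚ] Obj X deg n →ₗ[ℚ] Obj X deg p :=
  LinearMap.mk₂ ℚ (Quotient.map₂ (.br h) (fun _ _ h₁ _ _ h₂ => .br_congr h h₁ h₂))
    (by rintro ⟨a⟩ ⟨a'⟩ ⟨b⟩; exact mk_eq (.br_add_left h a a' b))
    (by rintro c ⟨a⟩ ⟨b⟩; exact mk_eq (.br_smul_left h c a b))
    (by rintro ⟨a⟩ ⟨b⟩ ⟨b'⟩; exact mk_eq (.br_add_right h a b b'))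
    (by rintro c ⟨a⟩ ⟨b⟩; exact mk_eq (.br_smul_right h c a b))

/-- The free graded Lie algebra over `ℚ` on a graded set of generators. -/
def free (X : Type u) (deg : X → ℤ) : GradedLie.{u} where
  obj := Obj X deg
  bracket := brk
  antisymm := by rintro m n p h ⟨a⟩ ⟨b⟩; exact mk_eq (.antisymm h _ a b)
  jacobi := by
    rintro l m n lm mn ln p hlm hmn hln h₁ h₂ h₃ ⟨a⟩ ⟨b⟩ ⟨c⟩
    exact mk_eq (.jacobi hlm hmn hln h₁ h₂ h₃ a b c)

theorem brk_antisymm {m n p : ℤ} (h : m + n = p) (h' : n + m = p) (x : Obj X deg m)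
    (y : Obj X deg n) : brk h x y = -((-1 : ℚ) ^ (m * n) • brk h' y x) :=
  (free X deg).antisymm h x y

theorem brk_jacobi {l m n lm mn ln p : ℤ} (hlm : l + m = lm) (hmn : m + n = mn) (hln : l + n = ln)
    (h₁ : l + mn = p) (h₂ : lm + n = p) (h₃ : m + ln = p) (x : Obj X deg l) (y : Obj X deg m)
    (z : Obj X deg n) : brk h₁ x (brk hmn y z) =
      brk h₂ (brk hlm x y) z + (-1 : ℚ) ^ (l * m) • brk h₃ y (brk hln x z) :=
  (free X deg).jacobi hlm hmn hln h₁ h₂ h₃ x y z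

/-- The degree `-1` derivation with prescribed values `D` on generators, on formal expressions. -/
def preDer (D : ∀ (x : X) (q : ℤ), q + 1 = deg x → Obj X deg q) :
    ∀ {p : ℤ}, Pre X deg p → ∀ q : ℤ, q + 1 = p → Obj X deg q
  | _, .of x h => fun q hq => D x q (hq.trans h.symm)
  | _, .zero => fun _ _ => 0
  | _, .add a b => fun q hq => preDer D a q hq + preDer D b q hq
  | _, .neg a => fun q hq => -preDer D a q hq
  | _, .smul c a => fun q hq => c • preDer D a q hq
  | _, .br (m := m) (n := n) h a b => fun q hq =>
      brk (show m - 1 + n = q by omega) (preDer D a (m - 1) (by omega)) (mk b) +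
        (-1 : ℚ) ^ m • brk (show m + (n - 1) = q by omega) (mk a) (preDer D b (n - 1) (by omega))

theorem sign_eq (n : ℤ) : (-1 : ℚ) ^ n = if Even n then 1 else -1 := by
  split_ifs with h
  · exact h.neg_one_zpow
  · exact (Int.not_even_iff_odd.1 h).neg_one_zpow

theorem mk_add {n : ℤ} (a b : Pre X deg n) : mk (.add a b) = mk a + mk b := rfl
theorem mk_neg {n : ℤ} (a : Pre X deg n) : mk (.neg a) = -mk a := rfl
theorem mk_smul {n : ℤ} (c : ℚ) (a : Pre X deg n) : mk (.smul c a) = c • mk a := rfl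
theorem mk_br {m n p : ℤ} (h : m + n = p) (a : Pre X deg m) (b : Pre X deg n) :
    mk (.br h a b) = brk h (mk a) (mk b) := rfl

theorem preDer_congr (D : ∀ (x : X) (q : ℤ), q + 1 = deg x → Obj X deg q) {p : ℤ}
    {a b : Pre X deg p} (hab : Rel X deg a b) (q : ℤ) (hq : q + 1 = p) :
    preDer D a q hq = preDer D b q hq := by
  induction hab generalizing q with
  | refl => rfl
  | symm _ ih => exact (ih _ _).symm
  | trans _ _ ih ih' => exact (ih _ _).trans (ih' _ _)
  | add_congr _ _ ih ih' => simp only [preDer, ih, ih']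
  | neg_congr _ ih => simp only [preDer, ih]
  | smul_congr _ _ ih => simp only [preDer, ih]
  | br_congr _ h h' ih ih' => simp only [preDer, ih, ih', mk_eq h, mk_eq h']
  | add_assoc => exact add_assoc _ _ _
  | add_comm => exact add_comm _ _
  | zero_add => exact zero_add _
  | neg_add => exact neg_add_cancel _
  | one_smul => exact one_smul _ _
  | mul_smul => exact mul_smul _ _ _
  | smul_add => exact smul_add _ _ _
  | add_smul => exact add_smul _ _ _
  | br_add_left =>
    simp only [preDer, mk_add, map_add, LinearMap.add_apply, smul_add]
    abel
  | br_smul_left =>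
    simp only [preDer, mk_smul, map_smul, LinearMap.smul_apply, smul_add]
    congr 1
    exact smul_comm _ _ _
  | br_add_right =>
    simp only [preDer, mk_add, map_add, smul_add]
    abel
  | br_smul_right =>
    simp only [preDer, mk_smul, map_smul, smul_add]
    congr 1
    exact smul_comm _ _ _
  | @antisymm m n p h h' a b =>
    simp only [preDer]
    rw [brk_antisymm (show m - 1 + n = q by omega) (show n + (m - 1) = q by omega),
      brk_antisymm (show m + (n - 1) = q by omega) (show n - 1 + m = q by omega)]
    simp only [sign_eq]
    by_cases hm : Even m <;> by_cases hn : Even n <;>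
      simp [hm, hn, Int.even_mul, ← Int.not_even_iff_odd]
  | @jacobi l m n lm mn ln p hlm hmn hln h₁ h₂ h₃ a b c =>
    simp only [preDer, mk_br, map_add, map_smul, LinearMap.add_apply, LinearMap.smul_apply]
    rw [brk_jacobi (lm := lm - 1) (ln := ln - 1) (by omega) hmn (by omega) (by omega) (by omega)
        (by omega) (preDer D a (l - 1) _),
      brk_jacobi (lm := lm - 1) (ln := ln) (by omega) (show m - 1 + n = mn - 1 by omega) (by omega)
        (by omega) (by omega) (by omega) (mk a),
      brk_jacobi (lm := lm) (ln := ln - 1) (by omega) (show m + (n - 1) = mn - 1 by omega)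
        (by omega) (by omega) (by omega) (by omega) (mk a)]
    simp only [sign_eq, ← hlm]
    by_cases hl : Even l <;> by_cases hm : Even m <;>
      simp [hl, hm, Int.even_mul, Int.even_add, ← Int.not_even_iff_odd] <;> abel

/-- The degree `-1` derivation of the free graded Lie algebra with prescribed values `D` on
generators. -/
def der (D : ∀ (x : X) (q : ℤ), q + 1 = deg x → Obj X deg q) (p q : ℤ) (hq : q + 1 = p) :
    Obj X deg p →ₗ[ℚ] Obj X deg q where
  toFun := Quotient.lift (fun a => preDer D a q hq) (fun _ _ h => preDer_congr D h q hq)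
  map_add' := by rintro ⟨a⟩ ⟨b⟩; rfl
  map_smul' := by rintro c ⟨a⟩; rfl

theorem der_mk (D : ∀ (x : X) (q : ℤ), q + 1 = deg x → Obj X deg q) {p : ℤ} (q : ℤ)
    (hq : q + 1 = p) (a : Pre X deg p) : der D p q hq (mk a) = preDer D a q hq := rfl

theorem der_leibniz (D : ∀ (x : X) (q : ℤ), q + 1 = deg x → Obj X deg q)
    {m n p m' n' p' : ℤ} (h : m + n = p) (hm : m' + 1 = m) (hn : n' + 1 = n)
    (hp : p' + 1 = p) (h₁ : m' + n = p') (h₂ : m + n' = p') (x : Obj X deg m) (y : Obj X deg n) :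
    der D p p' hp (brk h x y) =
      brk h₁ (der D m m' hm x) y + (-1 : ℚ) ^ m • brk h₂ x (der D n n' hn y) := by
  obtain rfl : m' = m - 1 := by omega
  obtain rfl : n' = n - 1 := by omega
  obtain ⟨a, rfl⟩ := mk_surjective x
  obtain ⟨b, rfl⟩ := mk_surjective y
  rfl

theorem der_der (D : ∀ (x : X) (q : ℤ), q + 1 = deg x → Obj X deg q)
    (hD : ∀ (x : X) (q r : ℤ) (hq : q + 1 = deg x) (hr : r + 1 = q), der D q r hr (D x q hq) = 0)
    {p q r : ℤ} (hq : q + 1 = p) (hr : r + 1 = q) (x : Obj X deg p) :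
    der D q r hr (der D p q hq x) = 0 := by
  obtain ⟨a, rfl⟩ := mk_surjective x
  induction a generalizing q r with
  | of x h => exact hD _ _ _ _ _
  | zero => exact map_zero _
  | add a b ih ih' => rw [mk_add, map_add, map_add, ih, ih', add_zero]
  | neg a ih => rw [mk_neg, map_neg, map_neg, ih, neg_zero]
  | smul c a ih => rw [mk_smul, map_smul, map_smul, ih, smul_zero]
  | @br m n p h a b ih ih' =>
    rw [mk_br, der_leibniz D h (m' := m - 1) (n' := n - 1) (by omega) (by omega) (by omega)
      (by omega) (by omega), map_add, map_smul,
      der_leibniz D (m := m - 1) (m' := m - 2) (n' := n - 1) (by omega) (by omega) (by omega)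
        (by omega) (by omega) (by omega),
      der_leibniz D (n := n - 1) (m' := m - 1) (n' := n - 2) (by omega) (by omega) (by omega)
        (by omega) (by omega) (by omega), ih, ih']
    simp only [map_zero, LinearMap.zero_apply, smul_zero, add_zero, zero_add, sign_eq]
    by_cases hm : Even m <;> simp [hm, ← Int.not_even_iff_odd]

/-- The free graded Lie algebra with the derivation determined by `D`, as a DGL. -/
def freeDGL (X : Type u) (deg : X → ℤ) (D : ∀ (x : X) (q : ℤ), q + 1 = deg x → Obj X deg q)
    (hD : ∀ (x : X) (q r : ℤ) (hq : q + 1 = deg x) (hr : r + 1 = q),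
      der D q r hr (D x q hq) = 0) : DGL.{u} where
  toGradedLie := free X deg
  d := der D
  d_d := fun h h' x => der_der D hD h h' x
  leibniz := der_leibniz D

end FreeLie

namespace Whitehead

open FreeLie

variable {k : ℕ}

/-- `∑_{i ∈ I} n_i - 1`, the degree of `u_I`. -/
def gdeg (n : Fin k → ℤ) (I : Finset (Fin k)) : ℤ := ∑ i ∈ I, n i - 1

/-- The index set of the generators `u_I`: nonempty proper subsets `I = {i₁ < ⋯ < i_s}` of
`{1, …, k}`. -/
abbrev Gen (k : ℕ) : Type := {I : Finset (Fin k) // I.Nonempty ∧ I ≠ Finset.univ}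

/-- The components of the free graded Lie algebra `𝕃(U)` on the generators `u_I`. -/
abbrev LU (n : Fin k → ℤ) : ℤ → Type := Obj (Gen k) (fun I => gdeg n I.1)

/-- The generator `u_I`, in the degree `p = |u_I|`. -/
def gen (n : Fin k → ℤ) (I : Gen k) {p : ℤ} (h : gdeg n I.1 = p) :
    LU n p := mk (.of I h)

/-- The Koszul sign of the shuffle rearranging `I = J ⊔ K` into (`J` in increasing order, followed
by `K` in increasing order), where the letter `i` has degree `n_i`: a factor `(-1)^(n_j n_i)` for
each inversion. -/
def koszul (n : Fin k → ℤ) (J K : Finset (Fin k)) : ℚ :=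
  ∏ j ∈ J, ∏ i ∈ K, if i < j then (-1 : ℚ) ^ (n j * n i) else 1

/-- The shuffles of `I` fixing its first element, each recorded by its first block `J`: proper
subsets `J` of `I` containing the least element of `I`. -/
def splits (I : Finset (Fin k)) : Finset (Finset (Fin k)) :=
  I.powerset.filter (fun J => J ≠ I ∧ ∃ i ∈ J, ∀ j ∈ I, i ≤ j)

theorem left_mem {I J : Finset (Fin k)} (h : J ∈ splits I) : J.Nonempty ∧ J ≠ Finset.univ := by
  simp only [splits, Finset.mem_filter, Finset.mem_powerset] at h
  obtain ⟨h₁, h₂, i, hi, -⟩ := h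
  refine ⟨⟨i, hi⟩, fun h => h₂ (Finset.Subset.antisymm h₁ ?_)⟩
  rw [h]
  exact Finset.subset_univ _

theorem right_mem {I J : Finset (Fin k)} (h : J ∈ splits I) :
    (I \ J).Nonempty ∧ I \ J ≠ Finset.univ := by
  simp only [splits, Finset.mem_filter, Finset.mem_powerset] at h
  obtain ⟨h₁, h₂, i, hi, -⟩ := h
  refine ⟨Finset.sdiff_nonempty.2 (fun h => h₂ (Finset.Subset.antisymm h₁ h)), fun h => ?_⟩
  have := Finset.mem_univ i
  rw [← h] at this
  exact (Finset.mem_sdiff.1 this).2 hi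

theorem splits_empty : splits (∅ : Finset (Fin k)) = ∅ := by
  refine Finset.eq_empty_of_forall_notMem fun J hJ => ?_
  obtain ⟨h, h', -⟩ := Finset.mem_filter.1 hJ
  exact h' (Finset.subset_empty.1 (Finset.mem_powerset.1 h))

theorem gdeg_sdiff (n : Fin k → ℤ) {I J : Finset (Fin k)} (h : J ⊆ I) :
    gdeg n J + gdeg n (I \ J) = gdeg n I - 1 := by
  have := Finset.sum_sdiff (f := n) h
  unfold gdeg
  omega

theorem subset_of_mem {I J : Finset (Fin k)} (h : J ∈ splits I) : J ⊆ I :=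
  Finset.mem_powerset.1 (Finset.mem_filter.1 h).1

/-- The element `∑_J ± [u_J, u_{I ∖ J}]`, of degree `q = |u_I| - 1`. -/
def bdry (n : Fin k → ℤ) (I : Finset (Fin k)) (q : ℤ) (hq : q + 1 = gdeg n I) :
    LU n q :=
  ∑ J ∈ (splits I).attach, (koszul n J.1 (I \ J.1) * (-1 : ℚ) ^ gdeg n J.1) •
    brk (show gdeg n J.1 + gdeg n (I \ J.1) = q by
        rw [gdeg_sdiff n (subset_of_mem J.2)]; omega)
      (gen n ⟨J.1, left_mem J.2⟩ rfl) (gen n ⟨I \ J.1, right_mem J.2⟩ rfl)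

section SquareZero

variable (n : Fin k → ℤ)

open Classical in
/-- The generator `u_I`, extended by zero to all `I`. -/
def tot (I : Finset (Fin k)) : LU n (gdeg n I) :=
  if h : I.Nonempty ∧ I ≠ Finset.univ then gen n ⟨I, h⟩ rfl else 0

theorem tot_empty : tot n ∅ = 0 := by simp [tot]

/-- The bracket into degree `q`, extended by zero. -/
def br0 (q : ℤ) {a b : ℤ} (x : LU n a)
    (y : LU n b) : LU n q :=
  if h : a + b = q then brk h x y else 0

theorem br0_eq {q a b : ℤ} (h : a + b = q) (x : LU n a) (y : LU n b) : br0 n q x y = brk h x y :=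
  dif_pos h

theorem koszul_union {A B C : Finset (Fin k)} (h : Disjoint A B) :
    koszul n (A ∪ B) C = koszul n A C * koszul n B C := by
  unfold koszul
  exact Finset.prod_union h

theorem koszul_sq (A B : Finset (Fin k)) : koszul n A B * koszul n A B = 1 := by
  unfold koszul
  simp only [← Finset.prod_mul_distrib]
  refine Finset.prod_eq_one fun i _ => Finset.prod_eq_one fun j _ => ?_
  split_ifs
  · rw [← mul_zpow]; simp
  · simp

theorem prod_sign {ι : Type*} (s : Finset ι) (f : ι → ℤ) :
    ∏ i ∈ s, (-1 : ℚ) ^ f i = (-1) ^ ∑ i ∈ s, f i := by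
  classical
  induction s using Finset.induction_on with
  | empty => simp
  | insert a s ha ih => rw [Finset.prod_insert ha, Finset.sum_insert ha, zpow_add₀ (by simp), ih]

theorem koszul_mul_swap {A B : Finset (Fin k)} (h : Disjoint A B) :
    koszul n A B * koszul n B A = (-1 : ℚ) ^ ((∑ i ∈ A, n i) * ∑ i ∈ B, n i) := by
  unfold koszul
  rw [Finset.prod_comm (s := B), ← Finset.prod_mul_distrib]
  simp only [← Finset.prod_mul_distrib]
  rw [Finset.sum_mul, ← prod_sign]
  refine Finset.prod_congr rfl fun i hi => ?_
  rw [Finset.mul_sum, ← prod_sign]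
  refine Finset.prod_congr rfl fun j hj => ?_
  have hij : i ≠ j := fun e => Finset.disjoint_left.1 h hi (e ▸ hj)
  rcases lt_or_gt_of_ne hij with h' | h'
  · rw [if_neg h'.not_gt, if_pos h', one_mul, mul_comm]
  · rw [if_pos h', if_neg h'.not_gt, mul_one]

theorem koszul_swap {A B : Finset (Fin k)} (h : Disjoint A B) :
    koszul n B A = (-1 : ℚ) ^ ((gdeg n A + 1) * (gdeg n B + 1)) * koszul n A B := by
  have h₁ := koszul_mul_swap n h
  have h₂ := koszul_sq n A B
  have e : (gdeg n A + 1) * (gdeg n B + 1) = (∑ i ∈ A, n i) * ∑ i ∈ B, n i := by simp [gdeg]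
  rw [e, ← h₁]
  linear_combination -(koszul n B A) * h₂

/-- The coefficient of `[u_J, u_K]`. -/
def coef (J K : Finset (Fin k)) : ℚ := koszul n J K * (-1 : ℚ) ^ gdeg n J

theorem coef_swap {J K : Finset (Fin k)} (h : Disjoint J K) :
    coef n K J = -((-1 : ℚ) ^ (gdeg n J * gdeg n K) * coef n J K) := by
  unfold coef
  rw [koszul_swap n h]
  simp only [sign_eq]
  by_cases hj : Even (gdeg n J) <;> by_cases hk : Even (gdeg n K) <;>
    simp [hj, hk, Int.even_mul]

theorem coef_br0_swap (q : ℤ) {J K : Finset (Fin k)} (h : Disjoint J K) :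
    coef n J K • br0 n q (tot n J) (tot n K) = coef n K J • br0 n q (tot n K) (tot n J) := by
  rw [coef_swap n h]
  by_cases hq : gdeg n J + gdeg n K = q
  · rw [br0_eq n hq, br0_eq n ((add_comm _ _).trans hq),
      brk_antisymm hq ((add_comm _ _).trans hq)]
    module
  · rw [br0, br0, dif_neg hq, dif_neg (fun h => hq ((add_comm _ _).trans h))]
    simp

theorem bdry_eq (I : Finset (Fin k)) (q : ℤ) (hq : q + 1 = gdeg n I) :
    (2 : ℚ) • bdry n I q hq =
      ∑ J ∈ I.powerset, coef n J (I \ J) • br0 n q (tot n J) (tot n (I \ J)) := by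
  classical
  set f : Finset (Fin k) → LU n q :=
    fun J => coef n J (I \ J) • br0 n q (tot n J) (tot n (I \ J)) with hf
  have h₁ : bdry n I q hq = ∑ J ∈ splits I, f J := by
    rw [← Finset.sum_attach, bdry]
    refine Finset.sum_congr rfl fun J _ => ?_
    have e : gdeg n J.1 + gdeg n (I \ J.1) = q := by
      rw [gdeg_sdiff n (subset_of_mem J.2)]; omega
    rw [hf]
    dsimp only
    rw [br0_eq n e, tot, tot, dif_pos (left_mem J.2), dif_pos (right_mem J.2), coef]
  have f0 : f ∅ = 0 := by
    rw [hf]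
    simp only [br0, tot_empty]
    split_ifs <;> simp
  have fI : f I = 0 := by
    rw [hf]
    dsimp only
    rw [Finset.sdiff_self, br0]
    split_ifs
    · rw [tot_empty, map_zero, smul_zero]
    · simp
  have fs : ∀ J ⊆ I, f (I \ J) = f J := by
    intro J hJ
    rw [hf]
    dsimp only
    rw [Finset.sdiff_sdiff_eq_self hJ]
    exact coef_br0_swap n q Finset.sdiff_disjoint
  rcases I.eq_empty_or_nonempty with rfl | hI
  · rw [h₁, splits_empty]
    simp [f0]
  let P : Finset (Fin k) → Prop := fun J => I.min' hI ∈ J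
  have h₂ : ∑ J ∈ splits I, f J = ∑ J ∈ I.powerset with P J, f J := by
    refine Finset.sum_subset (fun J hJ => ?_) (fun J hJ hJ' => ?_)
    · simp only [splits, Finset.mem_filter] at hJ ⊢
      obtain ⟨hJ, -, i, hi, hi'⟩ := hJ
      have : i = I.min' hI :=
        le_antisymm (hi' _ (I.min'_mem hI)) (I.min'_le _ (Finset.mem_powerset.1 hJ hi))
      exact ⟨hJ, by rwa [this] at hi⟩
    · simp only [splits, Finset.mem_filter] at hJ hJ'
      by_cases e : J = I
      · rw [e, fI]
      · exact absurd ⟨hJ.1, e, _, hJ.2, fun j hj => I.min'_le _ hj⟩ hJ'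
  have h₃ : ∑ J ∈ I.powerset with ¬ P J, f J = ∑ J ∈ I.powerset with P J, f J := by
    refine Finset.sum_nbij' (fun J => I \ J) (fun J => I \ J) ?_ ?_ ?_ ?_ ?_
    · intro J hJ
      simp only [Finset.mem_filter, Finset.mem_powerset, P] at hJ ⊢
      exact ⟨Finset.sdiff_subset, Finset.mem_sdiff.2 ⟨I.min'_mem hI, hJ.2⟩⟩
    · intro J hJ
      simp only [Finset.mem_filter, Finset.mem_powerset, P] at hJ ⊢
      exact ⟨Finset.sdiff_subset, fun h => (Finset.mem_sdiff.1 h).2 hJ.2⟩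
    · intro J hJ
      exact Finset.sdiff_sdiff_eq_self (Finset.mem_powerset.1 (Finset.mem_filter.1 hJ).1)
    · intro J hJ
      exact Finset.sdiff_sdiff_eq_self (Finset.mem_powerset.1 (Finset.mem_filter.1 hJ).1)
    · intro J hJ
      exact (fs J (Finset.mem_powerset.1 (Finset.mem_filter.1 hJ).1)).symm
  rw [← Finset.sum_filter_add_sum_filter_not I.powerset P, h₃, ← h₂, ← h₁, two_smul]

/-- The derivation `∂` of the free graded Lie algebra on the `u_I`. -/
abbrev del (p q : ℤ) (hq : q + 1 = p) :
    LU n p →ₗ[ℚ] LU n q :=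
  der (fun I => bdry n I.1) p q hq

theorem bdry_empty (q : ℤ) (hq : q + 1 = gdeg n (∅ : Finset (Fin k))) : bdry n ∅ q hq = 0 := by
  unfold bdry
  rw [Finset.sum_eq_zero]
  rintro ⟨J, hJ⟩
  rw [splits_empty] at hJ
  exact absurd hJ (Finset.notMem_empty _)

theorem del_tot {I : Finset (Fin k)} (hI : I ≠ Finset.univ) (q : ℤ) (hq : q + 1 = gdeg n I) :
    del n _ q hq (tot n I) = bdry n I q hq := by
  classical
  by_cases h : I.Nonempty
  · rw [tot, dif_pos ⟨h, hI⟩]; rfl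
  · obtain rfl := Finset.not_nonempty_iff_eq_empty.1 h
    rw [tot_empty, map_zero, bdry_empty]

/-- Ordered decompositions of `I` into three disjoint blocks. -/
def triples (I : Finset (Fin k)) : Finset (Finset (Fin k) × Finset (Fin k) × Finset (Fin k)) :=
  Finset.univ.filter fun t => Disjoint t.1 t.2.1 ∧ Disjoint t.1 t.2.2 ∧ Disjoint t.2.1 t.2.2 ∧
    t.1 ∪ t.2.1 ∪ t.2.2 = I

/-- The summand `± [[u_A, u_B], u_C]`. -/
def trip (r : ℤ) (A B C : Finset (Fin k)) : LU n r :=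
  (coef n (A ∪ B) C * coef n A B) •
    br0 n r (br0 n (gdeg n A + gdeg n B) (tot n A) (tot n B)) (tot n C)

theorem gdeg_union {A B : Finset (Fin k)} (h : Disjoint A B) :
    gdeg n (A ∪ B) = gdeg n A + gdeg n B + 1 := by
  unfold gdeg
  rw [Finset.sum_union h]
  ring

theorem trip_jacobi (r : ℤ) {A B C : Finset (Fin k)} (hr : gdeg n A + gdeg n B + gdeg n C = r)
    (hAB : Disjoint A B) (hAC : Disjoint A C) (hBC : Disjoint B C) :
    trip n r A B C + trip n r B C A + trip n r C A B = 0 := by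
  have hj := brk_jacobi (lm := gdeg n A + gdeg n B) (mn := gdeg n B + gdeg n C)
    (ln := gdeg n A + gdeg n C) (p := r) rfl rfl rfl (by omega) (by omega) (by omega)
    (tot n A) (tot n B) (tot n C)
  rw [brk_antisymm (m := gdeg n A) (n := gdeg n B + gdeg n C) (p := r) (by omega) (by omega),
    brk_antisymm (m := gdeg n B) (n := gdeg n A + gdeg n C) (p := r) (by omega) (by omega),
    brk_antisymm (m := gdeg n A) (n := gdeg n C) rfl (add_comm _ _)] at hj
  have e : ∀ (s t : ℤ) (hs : s = t) (h₁ : gdeg n C + gdeg n A = s) (h₂ : gdeg n C + gdeg n A = t)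
      (h₃ : s + gdeg n B = r) (h₄ : t + gdeg n B = r),
      brk h₃ (brk h₁ (tot n C) (tot n A)) (tot n B) =
        brk h₄ (brk h₂ (tot n C) (tot n A)) (tot n B) := by
    rintro s t rfl _ _ _ _; rfl
  simp only [map_neg, map_smul, LinearMap.neg_apply, LinearMap.smul_apply] at hj
  rw [e _ _ (add_comm (gdeg n A) (gdeg n C)) (add_comm _ _) rfl (by omega) (by omega)] at hj
  unfold trip
  rw [br0_eq n rfl, br0_eq n rfl, br0_eq n rfl, br0_eq n (by omega), br0_eq n (by omega),
    br0_eq n (by omega)]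
  unfold coef
  rw [koszul_union n hAB, koszul_union n hBC, koszul_union n hAC.symm, gdeg_union n hAB,
    gdeg_union n hBC, gdeg_union n hAC.symm, koszul_swap n hAB, koszul_swap n hAC,
    koszul_swap n hBC]
  generalize koszul n A B = κ₁
  generalize koszul n A C = κ₂
  generalize koszul n B C = κ₃
  revert hj
  simp only [sign_eq]
  by_cases ha : Even (gdeg n A) <;> by_cases hb : Even (gdeg n B) <;>
    by_cases hc : Even (gdeg n C) <;>
    simp only [ha, hb, hc, Int.even_mul, Int.even_add, if_true, if_false,
      not_true, or_true, or_false, iff_true,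
      iff_false, Int.not_even_one] <;>
    intro hj
  all_goals first
    | linear_combination (norm := module) (κ₁ * κ₂ * κ₃) • hj
    | linear_combination (norm := module) (-(κ₁ * κ₂ * κ₃)) • hj

theorem br0_zero_right (r : ℤ) {a b : ℤ} (x : LU n a) : br0 n r x (0 : LU n b) = 0 := by
  unfold br0
  split_ifs <;> simp

theorem br0_zero_left (r : ℤ) {a b : ℤ} (x : LU n b) : br0 n r (0 : LU n a) x = 0 := by
  unfold br0
  split_ifs <;> simp

theorem br0_br0 (r q : ℤ) {a b c : ℤ} (h : a + b = q) (x : LU n a) (y : LU n b) (z : LU n c) :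
    br0 n r (br0 n q x y) z = br0 n r (br0 n (a + b) x y) z := by
  subst h; rfl

/-- The summand `± [∂u_J, u_K]`. -/
def half (r : ℤ) (J K : Finset (Fin k)) : LU n r :=
  coef n J K • br0 n r (bdry n J (gdeg n J - 1) (by omega)) (tot n K)

theorem del_br0 {J K : Finset (Fin k)} (hd : Disjoint J K) {q r : ℤ} (hr : r + 1 = q)
    (hq : gdeg n J + gdeg n K = q) :
    coef n J K • del n q r hr (br0 n q (tot n J) (tot n K)) = half n r J K + half n r K J := by
  unfold half
  by_cases hJ : J = ∅
  · subst hJ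
    rw [tot_empty, bdry_empty, br0_zero_left, br0_zero_right, br0_zero_left]
    simp
  by_cases hK : K = ∅
  · subst hK
    rw [tot_empty, bdry_empty, br0_zero_left, br0_zero_right, br0_zero_right]
    simp
  have hJ' : J ≠ Finset.univ := by
    rintro rfl
    exact hK (Finset.eq_empty_of_forall_notMem fun x hx =>
      Finset.disjoint_left.1 hd (Finset.mem_univ x) hx)
  have hK' : K ≠ Finset.univ := by
    rintro rfl
    exact hJ (Finset.eq_empty_of_forall_notMem fun x hx =>
      Finset.disjoint_left.1 hd hx (Finset.mem_univ x))
  rw [br0_eq n hq, der_leibniz _ hq (m' := gdeg n J - 1) (n' := gdeg n K - 1) (by omega) (by omega)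
    hr (by omega) (by omega), del_tot n hJ', del_tot n hK', br0_eq n (by omega),
    br0_eq n (by omega), coef_swap n hd,
    brk_antisymm (m := gdeg n J) (n := gdeg n K - 1) (by omega) (by omega)]
  simp only [sign_eq]
  by_cases ha : Even (gdeg n J) <;> by_cases hb : Even (gdeg n K) <;>
    simp [ha, hb, Int.even_mul, ← Int.not_even_iff_odd]

theorem two_half {I J : Finset (Fin k)} (r : ℤ) :
    (2 : ℚ) • half n r J (I \ J) = ∑ A ∈ J.powerset, trip n r A (J \ A) (I \ J) := by
  by_cases h : gdeg n J - 1 + gdeg n (I \ J) = r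
  · unfold half
    rw [br0_eq n h, smul_comm, ← LinearMap.map_smul₂, bdry_eq, map_sum,
      LinearMap.sum_apply, Finset.smul_sum]
    refine Finset.sum_congr rfl fun A hA => ?_
    have hA := Finset.mem_powerset.1 hA
    unfold trip
    rw [Finset.union_sdiff_of_subset hA, map_smul, LinearMap.smul_apply, ← br0_eq n h,
      br0_br0 n r _ (gdeg_sdiff n hA), smul_smul]
  · unfold half
    rw [br0, dif_neg h, smul_zero, smul_zero]
    refine (Finset.sum_eq_zero fun A hA => ?_).symm
    have := gdeg_sdiff n (Finset.mem_powerset.1 hA)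
    unfold trip
    rw [br0, dif_neg (by omega), smul_zero]

theorem sum_triples (I : Finset (Fin k)) {M : Type*} [AddCommMonoid M]
    (f : Finset (Fin k) → Finset (Fin k) → Finset (Fin k) → M) :
    ∑ J ∈ I.powerset, ∑ A ∈ J.powerset, f A (J \ A) (I \ J) =
      ∑ t ∈ triples I, f t.1 t.2.1 t.2.2 := by
  rw [Finset.sum_sigma']
  refine Finset.sum_bij' (fun s _ => (s.2, s.1 \ s.2, I \ s.1)) (fun t _ => ⟨t.1 ∪ t.2.1, t.1⟩)
    ?_ ?_ ?_ ?_ ?_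
  · rintro ⟨J, A⟩ h
    simp only [Finset.mem_sigma, Finset.mem_powerset] at h
    obtain ⟨hJ, hA⟩ := h
    simp only [triples, Finset.mem_filter, Finset.mem_univ, true_and]
    refine ⟨Finset.disjoint_sdiff, ?_, ?_, ?_⟩
    · exact Finset.disjoint_of_subset_left hA Finset.disjoint_sdiff
    · exact Finset.disjoint_of_subset_left Finset.sdiff_subset Finset.disjoint_sdiff
    · rw [Finset.union_sdiff_of_subset hA, Finset.union_sdiff_of_subset hJ]
  · rintro ⟨A, B, C⟩ h
    simp only [triples, Finset.mem_filter, Finset.mem_univ, true_and] at h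
    obtain ⟨-, -, -, rfl⟩ := h
    simp only [Finset.mem_sigma, Finset.mem_powerset]
    exact ⟨Finset.subset_union_left, Finset.subset_union_left⟩
  · rintro ⟨J, A⟩ h
    simp only [Finset.mem_sigma, Finset.mem_powerset] at h
    simp only [Finset.union_sdiff_of_subset h.2]
  · rintro ⟨A, B, C⟩ h
    simp only [triples, Finset.mem_filter, Finset.mem_univ, true_and] at h
    obtain ⟨h₁, h₂, h₃, rfl⟩ := h
    simp only [Prod.mk.injEq, true_and]
    exact ⟨Finset.union_sdiff_cancel_left h₁,
      Finset.union_sdiff_cancel_left (Finset.disjoint_union_left.2 ⟨h₂, h₃⟩)⟩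
  · rintro ⟨J, A⟩ h
    rfl

theorem sum_rotate (I : Finset (Fin k)) {M : Type*} [AddCommMonoid M]
    (f : Finset (Fin k) → Finset (Fin k) → Finset (Fin k) → M) :
    ∑ t ∈ triples I, f t.2.1 t.2.2 t.1 = ∑ t ∈ triples I, f t.1 t.2.1 t.2.2 := by
  refine Finset.sum_nbij' (fun t => (t.2.1, t.2.2, t.1)) (fun t => (t.2.2, t.1, t.2.1))
    ?_ ?_ ?_ ?_ ?_
  · rintro ⟨A, B, C⟩ h
    simp only [triples, Finset.mem_filter, Finset.mem_univ, true_and] at h ⊢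
    obtain ⟨h₁, h₂, h₃, rfl⟩ := h
    exact ⟨h₃, h₁.symm, h₂.symm, by rw [Finset.union_comm, ← Finset.union_assoc]⟩
  · rintro ⟨A, B, C⟩ h
    simp only [triples, Finset.mem_filter, Finset.mem_univ, true_and] at h ⊢
    obtain ⟨h₁, h₂, h₃, rfl⟩ := h
    exact ⟨h₂.symm, h₃.symm, h₁, by rw [Finset.union_assoc, Finset.union_comm]⟩
  · intro t _; rfl
  · intro t _; rfl
  · intro t _; rfl

theorem del_bdry (I : Finset (Fin k)) (q r : ℤ) (hq : q + 1 = gdeg n I) (hr : r + 1 = q) :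
    del n q r hr (bdry n I q hq) = 0 := by
  have h₁ : (2 : ℚ) • del n q r hr (bdry n I q hq) =
      ∑ J ∈ I.powerset, (half n r J (I \ J) + half n r (I \ J) J) := by
    rw [← map_smul, bdry_eq, map_sum]
    refine Finset.sum_congr rfl fun J hJ => ?_
    rw [map_smul, del_br0 n Finset.disjoint_sdiff hr]
    rw [gdeg_sdiff n (Finset.mem_powerset.1 hJ)]
    omega
  have h₂ : ∑ J ∈ I.powerset, half n r (I \ J) J = ∑ J ∈ I.powerset, half n r J (I \ J) := by
    refine Finset.sum_nbij' (fun J => I \ J) (fun J => I \ J) ?_ ?_ ?_ ?_ ?_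
    · intro J _
      exact Finset.mem_powerset.2 Finset.sdiff_subset
    · intro J _
      exact Finset.mem_powerset.2 Finset.sdiff_subset
    · intro J hJ
      exact Finset.sdiff_sdiff_eq_self (Finset.mem_powerset.1 hJ)
    · intro J hJ
      exact Finset.sdiff_sdiff_eq_self (Finset.mem_powerset.1 hJ)
    · intro J hJ
      rw [Finset.sdiff_sdiff_eq_self (Finset.mem_powerset.1 hJ)]
  have h₃ : (2 : ℚ) • ∑ J ∈ I.powerset, half n r J (I \ J) =
      ∑ t ∈ triples I, trip n r t.1 t.2.1 t.2.2 := by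
    rw [Finset.smul_sum, ← sum_triples I (trip n r)]
    exact Finset.sum_congr rfl fun J _ => two_half n r
  have h₄ : (3 : ℚ) • ∑ t ∈ triples I, trip n r t.1 t.2.1 t.2.2 = 0 := by
    have e₁ := sum_rotate I (trip n r)
    have e₂ := sum_rotate I (fun A B C => trip n r B C A)
    have : ∑ t ∈ triples I, (trip n r t.1 t.2.1 t.2.2 + trip n r t.2.1 t.2.2 t.1 +
        trip n r t.2.2 t.1 t.2.1) = 0 := by
      refine Finset.sum_eq_zero ?_
      rintro ⟨A, B, C⟩ h
      simp only [triples, Finset.mem_filter, Finset.mem_univ, true_and] at h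
      obtain ⟨hAB, hAC, hBC, rfl⟩ := h
      refine trip_jacobi n r ?_ hAB hAC hBC
      change gdeg n A + gdeg n B + gdeg n C = r
      have := gdeg_union n (Finset.disjoint_union_left.2 ⟨hAC, hBC⟩)
      have := gdeg_union n hAB
      omega
    rw [Finset.sum_add_distrib, Finset.sum_add_distrib] at this
    rw [e₂, e₁] at this
    rw [← this]
    module
  rw [Finset.sum_add_distrib, h₂] at h₁
  have h₅ : ∑ t ∈ triples I, trip n r t.1 t.2.1 t.2.2 = 0 :=
    (smul_eq_zero.1 h₄).resolve_left (by norm_num)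
  rw [h₅] at h₃
  rw [(smul_eq_zero.1 h₃).resolve_left (by norm_num), add_zero] at h₁
  exact (smul_eq_zero.1 h₁).resolve_left (by norm_num)

end SquareZero

/-- The DGL `𝕃(U)`: the free graded Lie algebra on the generators `u_I`, of degree
`∑_{i ∈ I} n_i - 1`, with `∂u_I = ∑_J ± [u_J, u_{I ∖ J}]`. -/
def lieU (n : Fin k → ℤ) : DGL :=
  freeDGL (Gen k) (fun I => gdeg n I.1) (fun I => bdry n I.1) (fun I => del_bdry n I.1)

/-- The singleton `{i}` is a proper subset when `k ≥ 2`. -/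
def single (hk : 2 ≤ k) (i : Fin k) : Gen k :=
  ⟨{i}, Finset.singleton_nonempty i, fun h => by
    have := congrArg Finset.card h
    simp at this
    omega⟩

theorem gdeg_single (n : Fin k → ℤ) (hk : 2 ≤ k) (i : Fin k) :
    gdeg n (single hk i).1 = n i - 1 := by
  simp [gdeg, single]

/-- The generator `u_i`, of degree `n_i - 1`. -/
def u (n : Fin k → ℤ) (hk : 2 ≤ k) (i : Fin k) : (lieU n).obj (n i - 1) :=
  gen n (single hk i) (gdeg_single n hk i)

theorem w_degree (n : Fin k → ℤ) : (∑ i, n i) - 2 + 1 = gdeg n Finset.univ := by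
  unfold gdeg; ring

/-- The element `w ∈ 𝕃(U)`, of degree `n_1 + ⋯ + n_k - 2`: the right-hand side of the formula for
`∂u_I` with `I = {1, …, k}` (which is not the index of a generator). -/
def w (n : Fin k → ℤ) : (lieU n).obj ((∑ i, n i) - 2) :=
  bdry n Finset.univ _ (w_degree n)

theorem w_mem_cycles (n : Fin k → ℤ) : w n ∈ (lieU n).cycles ((∑ i, n i) - 2) :=
  del_bdry n Finset.univ _ _ _ _

/-- The `k`-th order Whitehead bracket set computed with the elements `a_i ∈ L_{n_i - 1}`: the
homology classes of `φ(w)`, where `φ` runs over all DGL morphisms `𝕃(U) → L` extending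
`u_i ↦ a_i`.  When `a_i` is a cycle representing `x_i`, this is `[x_1, …, x_k]`. -/
def bracketSet (L : DGL.{u}) (hk : 2 ≤ k) (n : Fin k → ℤ) (a : ∀ i, L.obj (n i - 1)) :
    Set (L.H ((∑ i, n i) - 2)) :=
  {c | ∃ φ : DGL.Hom (lieU n) L, (∀ i, φ.map _ (u n hk i) = a i) ∧
    c = L.cls ⟨φ.map _ (w n), φ.map_mem_cycles (w_mem_cycles n)⟩}

end Whitehead

/-! A morphism out of `𝕃(U)` is the same as a family `c_I` with `∂c_I` equal to the value at `c` of
the formula for `∂u_I`, for all proper `I`. Up to signs, this is a Maurer–Cartan equation `∂c = ½[c,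
c]` for `∑ c_I ε_I`, where `ε_i² = 0` and the equation is taken modulo `ε_1⋯ε_k`. The image of `w`
is the obstruction to solving it in the top component as well.

The main point is that a quasi-isomorphism `f : A → B` carries the bracket sets of `A` exactly onto
those of `B`, whatever representing cycles are chosen (`bracketSet_eq_image`). One inclusion is
composition with `f`. For the other, a family `ψ` in `B` must be lifted. Along increasing `I`,
injectivity and surjectivity of `f` on homology give `x` in `A` with the required differential and
`f(x) - ψ_I = ∂h`. The gauge transformation of `ψ` by `h ε_I` turns this into a strict equality. It
alters only components above `I` and changes the top obstruction by a boundary (`ob_gauge`). Since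
`ε_I² = 0`, the gauge action is exactly its linear part, so no exponential series occurs. The case
`f = id` gives independence of the representatives.

Consequently a zig-zag induces an isomorphism of homology matching bracket sets
(`exists_homology_iso`). If `L` is formal, its bracket set is therefore in bijection with the one
computed in `H`, with `0` corresponding to `0`. In `H` a non-empty bracket set of order at least 3
contains `0`: non-emptiness forces the brackets `[x_i, x_j]` to vanish, so every `u_I` with `|I| ≥
2` may be sent to `0` (`zero_mem_bracketSet`). Both conditions of the theorem are thus contradicted.
-/

namespace GradedLie

/-- The bracket into degree `q`, extended by zero. -/
def br0 (G : GradedLie.{u}) (q : ℤ) {a b : ℤ} : G.obj a →ₗ[ℚ] G.obj b →ₗ[ℚ] G.obj q :=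
  if h : a + b = q then G.bracket h else 0

variable (G : GradedLie.{u})

theorem br0_eq {q a b : ℤ} (h : a + b = q) (x : G.obj a) (y : G.obj b) :
    G.br0 q x y = G.bracket h x y := by
  rw [br0, dif_pos h]

theorem br0_of_ne {q a b : ℤ} (h : a + b ≠ q) (x : G.obj a) (y : G.obj b) :
    G.br0 q x y = 0 := by
  rw [br0, dif_neg h]; rfl

end GradedLie

/-! ### Universal property of the free graded Lie algebra and of free DGLs. -/

namespace FreeLie

variable {X : Type u} {deg : X → ℤ} (G : GradedLie.{v}) (g : ∀ x, G.obj (deg x))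

/-- Evaluation of a formal expression in a graded Lie algebra. -/
def preLift : ∀ {p : ℤ}, Pre X deg p → G.obj p
  | _, .of x h => h ▸ g x
  | _, .zero => 0
  | _, .add a b => preLift a + preLift b
  | _, .neg a => -preLift a
  | _, .smul c a => c • preLift a
  | _, .br h a b => G.bracket h (preLift a) (preLift b)

theorem preLift_congr {p : ℤ} {a b : Pre X deg p} (hab : Rel X deg a b) :
    preLift G g a = preLift G g b := by
  induction hab with
  | refl => rfl
  | symm _ ih => exact ih.symm
  | trans _ _ ih ih' => exact ih.trans ih'
  | add_congr _ _ ih ih' => simp only [preLift, ih, ih']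
  | neg_congr _ ih => simp only [preLift, ih]
  | smul_congr _ _ ih => simp only [preLift, ih]
  | br_congr _ _ _ ih ih' => simp only [preLift, ih, ih']
  | add_assoc => exact add_assoc _ _ _
  | add_comm => exact add_comm _ _
  | zero_add => exact zero_add _
  | neg_add => exact neg_add_cancel _
  | one_smul => exact one_smul _ _
  | mul_smul => exact mul_smul _ _ _
  | smul_add => exact smul_add _ _ _
  | add_smul => exact add_smul _ _ _
  | br_add_left => simp only [preLift, map_add, LinearMap.add_apply]
  | br_smul_left => simp only [preLift, map_smul, LinearMap.smul_apply]
  | br_add_right => simp only [preLift, map_add]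
  | br_smul_right => simp only [preLift, map_smul]
  | antisymm h h' a b => exact G.antisymm h _ _
  | jacobi hlm hmn hln h₁ h₂ h₃ a b c => exact G.jacobi hlm hmn hln h₁ h₂ h₃ _ _ _

/-- The morphism of graded Lie algebras extending a map on generators. -/
def lift (p : ℤ) : Obj X deg p →ₗ[ℚ] G.obj p where
  toFun := Quotient.lift (fun a => preLift G g a) (fun _ _ h => preLift_congr G g h)
  map_add' := by rintro ⟨a⟩ ⟨b⟩; rfl
  map_smul' := by rintro c ⟨a⟩; rfl

theorem lift_brk {m n p : ℤ} (h : m + n = p) (x : Obj X deg m) (y : Obj X deg n) :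
    lift G g p (brk h x y) = G.bracket h (lift G g m x) (lift G g n y) := by
  obtain ⟨a, rfl⟩ := mk_surjective x
  obtain ⟨b, rfl⟩ := mk_surjective y
  rfl

/-- A family of linear maps respecting brackets is determined by its values on generators. -/
theorem eq_lift (F : ∀ p, Obj X deg p →ₗ[ℚ] G.obj p)
    (hF : ∀ {m n p : ℤ} (h : m + n = p) (x : Obj X deg m) (y : Obj X deg n),
      F p (brk h x y) = G.bracket h (F m x) (F n y))
    (hg : ∀ x, F (deg x) (mk (.of x rfl)) = g x) (p : ℤ) (x : Obj X deg p) :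
    F p x = lift G g p x := by
  obtain ⟨a, rfl⟩ := mk_surjective x
  induction a with
  | of x h => subst h; exact hg x
  | zero => exact (map_zero _).trans (map_zero (lift G g _)).symm
  | add a b ih ih' => rw [mk_add, map_add, map_add, ih, ih']
  | neg a ih => rw [mk_neg, map_neg, map_neg, ih]
  | smul c a ih => rw [mk_smul, map_smul, map_smul, ih]
  | br h a b ih ih' => rw [mk_br, hF, ih, ih', lift_brk]

theorem map_lift {A : DGL.{u}} {B : DGL.{v}} (f : DGL.Hom A B) {Y : Type*} {dY : Y → ℤ}
    (g : ∀ x, A.obj (dY x)) (p : ℤ) (x : Obj Y dY p) :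
    f.map p (lift A.toGradedLie g p x) = lift B.toGradedLie (fun x => f.map _ (g x)) p x :=
  eq_lift B.toGradedLie (fun x => f.map _ (g x))
    (fun p => f.map p ∘ₗ lift A.toGradedLie g p)
    (fun h x y => by simp only [LinearMap.comp_apply, lift_brk]; exact f.map_bracket h _ _)
    (fun x => rfl) p x

variable (L : DGL.{v}) (g : ∀ x, L.obj (deg x))
  (D : ∀ (x : X) (q : ℤ), q + 1 = deg x → Obj X deg q)

/-- If a lift commutes with differentials on two elements, then it does so on their bracket. -/
theorem lift_der_brk {m n p : ℤ} (h : m + n = p) (x : Obj X deg m) (y : Obj X deg n)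
    (hx : ∀ q hq, lift L.toGradedLie g q (der D m q hq x) =
      L.d m q hq (lift L.toGradedLie g m x))
    (hy : ∀ q hq, lift L.toGradedLie g q (der D n q hq y) =
      L.d n q hq (lift L.toGradedLie g n y)) (q : ℤ) (hq : q + 1 = p) :
    lift L.toGradedLie g q (der D p q hq (brk h x y)) =
      L.d p q hq (lift L.toGradedLie g p (brk h x y)) := by
  rw [der_leibniz D h (m' := m - 1) (n' := n - 1) (by omega) (by omega) hq (by omega) (by omega),
    lift_brk, L.leibniz h (m' := m - 1) (n' := n - 1) (by omega) (by omega) hq (by omega)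
      (by omega), map_add, map_smul, lift_brk, lift_brk, hx, hy]

/-- Both sides are derivations along the lift, so agreement on generators propagates through
brackets by `lift_der_brk`. -/
theorem lift_der (hg : ∀ x q hq, lift L.toGradedLie g q (D x q hq) = L.d _ q hq (g x))
    {p : ℤ} (x : Obj X deg p) (q : ℤ) (hq : q + 1 = p) :
    lift L.toGradedLie g q (der D p q hq x) = L.d p q hq (lift L.toGradedLie g p x) := by
  obtain ⟨a, rfl⟩ := mk_surjective x
  induction a generalizing q with
  | of x h => subst h; exact hg x q hq
  | zero => rw [show (mk .zero : Obj X deg _) = 0 from rfl]; simp only [map_zero]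
  | add a b ih ih' => rw [mk_add]; simp only [map_add, ih, ih']
  | neg a ih => rw [mk_neg]; simp only [map_neg, ih]
  | smul c a ih => rw [mk_smul]; simp only [map_smul, ih]
  | br h a b ih ih' => exact lift_der_brk L g D h _ _ ih ih' q hq

end FreeLie

namespace Whitehead

open FreeLie

variable {k : ℕ} (n : Fin k → ℤ)

/-! ### Evaluating the formula for `∂u_I` on a family of elements. -/

section Eval

variable (G : GradedLie.{u}) (c : ∀ I : Finset (Fin k), G.obj (gdeg n I))

/-- The graded Lie morphism `u_I ↦ c_I`. -/
abbrev eval (p : ℤ) : LU n p →ₗ[ℚ] G.obj p := lift G (fun I : Gen k => c I.1) p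

/-- The value at `c` of the formula for `∂u_I`. -/
def ob (I : Finset (Fin k)) (q : ℤ) (hq : q + 1 = gdeg n I) : G.obj q :=
  eval n G c q (bdry n I q hq)

theorem ob_eq_sum (I : Finset (Fin k)) (q : ℤ) (hq : q + 1 = gdeg n I) :
    ob n G c I q hq = ∑ J ∈ (splits I).attach, coef n J.1 (I \ J.1) •
      G.bracket (show gdeg n J.1 + gdeg n (I \ J.1) = q by
        rw [gdeg_sdiff n (subset_of_mem J.2)]; omega) (c J.1) (c (I \ J.1)) := by
  unfold ob bdry
  rw [map_sum]
  refine Finset.sum_congr rfl fun J _ => ?_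
  rw [map_smul, lift_brk]
  rfl

theorem ssubset_of_mem_splits {I J : Finset (Fin k)} (h : J ∈ splits I) : J ⊂ I :=
  Finset.ssubset_iff_subset_ne.2 ⟨subset_of_mem h, (Finset.mem_filter.1 h).2.1⟩

theorem sdiff_ssubset_of_mem_splits {I J : Finset (Fin k)} (h : J ∈ splits I) : I \ J ⊂ I :=
  Finset.sdiff_ssubset (subset_of_mem h) (left_mem h).1

/-- Only blocks that are nonempty and strictly smaller than `I` enter the formula. This is what
permits constructing families by induction over subsets. -/
theorem ob_congr {c c' : ∀ I : Finset (Fin k), G.obj (gdeg n I)} {I : Finset (Fin k)}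
    (h : ∀ J, J.Nonempty → J ⊂ I → c J = c' J) (q : ℤ) (hq : q + 1 = gdeg n I) :
    ob n G c I q hq = ob n G c' I q hq := by
  rw [ob_eq_sum, ob_eq_sum]
  refine Finset.sum_congr rfl fun J _ => ?_
  rw [h _ (left_mem J.2).1 (ssubset_of_mem_splits J.2),
    h _ (right_mem J.2).1 (sdiff_ssubset_of_mem_splits J.2)]

theorem eval_br0 (q : ℤ) {a b : ℤ} (x : LU n a) (y : LU n b) :
    eval n G c q (br0 n q x y) = G.br0 q (eval n G c a x) (eval n G c b y) := by
  by_cases h : a + b = q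
  · rw [Whitehead.br0_eq n h, G.br0_eq h, lift_brk]
  · rw [G.br0_of_ne h, br0, dif_neg h, map_zero]

theorem eval_tot {I : Finset (Fin k)} (h : I.Nonempty ∧ I ≠ Finset.univ) :
    eval n G c _ (tot n I) = c I := by
  rw [tot, dif_pos h]
  rfl

/-- Symmetrization: dropping the condition `min I ∈ J` counts each splitting twice, and the added
terms `J = ∅` and `J = I` vanish because `c ∅ = 0`. The sum over all subsets can be reindexed
freely. -/
theorem two_ob (hc : c ∅ = 0) (I : Finset (Fin k)) (q : ℤ) (hq : q + 1 = gdeg n I) :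
    (2 : ℚ) • ob n G c I q hq =
      ∑ J ∈ I.powerset, coef n J (I \ J) • G.br0 q (c J) (c (I \ J)) := by
  unfold ob
  rw [← map_smul, bdry_eq, map_sum]
  refine Finset.sum_congr rfl fun J hJ => ?_
  have hJ := Finset.mem_powerset.1 hJ
  rw [map_smul, eval_br0]
  rcases J.eq_empty_or_nonempty with rfl | h₁
  · rw [tot_empty, hc, map_zero, map_zero, LinearMap.zero_apply, LinearMap.zero_apply]
  rcases (I \ J).eq_empty_or_nonempty with h₂ | h₂
  · generalize I \ J = K at *
    subst h₂
    rw [tot_empty, hc, map_zero, map_zero, map_zero]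
  · rw [eval_tot, eval_tot]
    · refine ⟨h₂, fun h => ?_⟩
      obtain ⟨x, hx⟩ := h₁
      exact (Finset.mem_sdiff.1 (h ▸ Finset.mem_univ x)).2 hx
    · refine ⟨h₁, fun h => ?_⟩
      obtain ⟨x, hx⟩ := h₂
      exact (Finset.mem_sdiff.1 hx).2 (h ▸ Finset.mem_univ x)

theorem coef_glie_br0_swap (q : ℤ) {J K : Finset (Fin k)} (h : Disjoint J K)
    (x : G.obj (gdeg n J)) (y : G.obj (gdeg n K)) :
    coef n J K • G.br0 q x y = coef n K J • G.br0 q y x := by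
  rw [coef_swap n h]
  by_cases hq : gdeg n J + gdeg n K = q
  · rw [G.br0_eq hq, G.br0_eq ((add_comm _ _).trans hq), G.antisymm hq]
    module
  · rw [G.br0_of_ne hq, G.br0_of_ne (fun h => hq ((add_comm _ _).trans h))]
    simp

theorem sum_powerset_sdiff {M : Type*} [AddCommMonoid M] (I : Finset (Fin k))
    (f : Finset (Fin k) → M) : ∑ J ∈ I.powerset, f (I \ J) = ∑ J ∈ I.powerset, f J := by
  refine Finset.sum_nbij' (fun J => I \ J) (fun J => I \ J) ?_ ?_ ?_ ?_ ?_
  · exact fun J _ => Finset.mem_powerset.2 Finset.sdiff_subset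
  · exact fun J _ => Finset.mem_powerset.2 Finset.sdiff_subset
  · exact fun J hJ => Finset.sdiff_sdiff_eq_self (Finset.mem_powerset.1 hJ)
  · exact fun J hJ => Finset.sdiff_sdiff_eq_self (Finset.mem_powerset.1 hJ)
  · exact fun J _ => rfl

/-- The Jacobi identity for `[h, [c_A, c_B]]`, with the signs of the gauge action. -/
theorem gauge_jacobi {I A B : Finset (Fin k)} (hIA : Disjoint I A) (hIB : Disjoint I B)
    (hAB : Disjoint A B) (q r : ℤ) (hr : r + 1 = gdeg n (A ∪ B))
    (hq : gdeg n I + 1 + r = q) (h : G.obj (gdeg n I + 1)) (x : G.obj (gdeg n A))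
    (y : G.obj (gdeg n B)) :
    (coef n I (A ∪ B) * (-1 : ℚ) ^ (gdeg n I + 1) * coef n A B) • G.br0 q h (G.br0 r x y) =
      (coef n (I ∪ A) B * coef n I A) • G.br0 q (G.br0 (gdeg n (I ∪ A)) h x) y +
      (coef n (I ∪ B) A * coef n I B) • G.br0 q (G.br0 (gdeg n (I ∪ B)) h y) x := by
  have e := gdeg_union n hAB
  have eA := gdeg_union n hIA
  have eB := gdeg_union n hIB
  have hj := G.jacobi (lm := gdeg n (I ∪ A)) (mn := r) (ln := gdeg n (I ∪ B)) (p := q)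
    (by omega) (by omega) (by omega) hq (by omega) (by omega) h x y
  rw [G.antisymm (m := gdeg n A) (n := gdeg n (I ∪ B)) (p := q) (by omega)] at hj
  rw [G.br0_eq (by omega), G.br0_eq (by omega), G.br0_eq (by omega), G.br0_eq (by omega),
    G.br0_eq (by omega), G.br0_eq (by omega), hj]
  have kd : koszul n I (A ∪ B) = koszul n I A * koszul n I B := by
    unfold koszul
    rw [← Finset.prod_mul_distrib]
    exact Finset.prod_congr rfl fun i _ => Finset.prod_union hAB
  have sA : (-1 : ℚ) ^ gdeg n (I ∪ A) = (-1) ^ (gdeg n I + gdeg n A + 1) := by rw [eA]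
  have sB : (-1 : ℚ) ^ gdeg n (I ∪ B) = (-1) ^ (gdeg n I + gdeg n B + 1) := by rw [eB]
  have sAB : (-1 : ℚ) ^ (gdeg n A * gdeg n (I ∪ B)) =
      (-1) ^ (gdeg n A * (gdeg n I + gdeg n B + 1)) := by rw [eB]
  unfold coef
  rw [kd, koszul_union n hIA, koszul_union n hIB, sA, sB, sAB, koszul_swap n hAB]
  -- All three terms now carry the same product of Koszul signs, so only the parities of the three
  -- degrees matter.
  generalize koszul n A B = κ₁
  generalize koszul n I A = κ₂
  generalize koszul n I B = κ₃
  simp only [sign_eq]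
  by_cases ha : Even (gdeg n A) <;> by_cases hb : Even (gdeg n B) <;>
    by_cases hc : Even (gdeg n I) <;>
    simp only [ha, hb, hc, Int.even_mul, Int.even_add, if_true, if_false,
      not_true, or_true, or_false, iff_true,
      iff_false, Int.not_even_one] <;>
    module

end Eval

/-! ### Gauge transformations of compatible families. -/

section Gauge

variable (L : DGL.{u}) (c : ∀ I : Finset (Fin k), L.obj (gdeg n I))
  (I : Finset (Fin k)) (h : L.obj (gdeg n I + 1))

/-- The inner part of the infinitesimal gauge transformation by `h` at `u_I`. -/
def gaugeInner (K : Finset (Fin k)) : L.obj (gdeg n K) :=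
  if I ⊆ K then coef n I (K \ I) • L.br0 (gdeg n K) h (c (K \ I)) else 0

/-- The outer part of the infinitesimal gauge transformation by `h` at `u_I`. -/
def gaugeOuter (K : Finset (Fin k)) : L.obj (gdeg n K) :=
  if e : I = K then L.d _ (gdeg n K) (by rw [e]) h else 0

theorem gaugeOuter_self : gaugeOuter n L I h I = L.d _ (gdeg n I) rfl h := dif_pos rfl

/-- The infinitesimal gauge transformation by `h` at `u_I`. -/
def gaugeDelta (K : Finset (Fin k)) : L.obj (gdeg n K) :=
  gaugeOuter n L I h K + gaugeInner n L c I h K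

theorem gaugeDelta_of_not_subset {K : Finset (Fin k)} (hK : ¬ I ⊆ K) :
    gaugeDelta n L c I h K = 0 := by
  rw [gaugeDelta, gaugeOuter, gaugeInner, if_neg hK, dif_neg, add_zero]
  rintro rfl
  exact hK subset_rfl

theorem gaugeDelta_self (hc : c ∅ = 0) : gaugeDelta n L c I h I = L.d _ (gdeg n I) rfl h := by
  rw [gaugeDelta, gaugeInner, if_pos subset_rfl, gaugeOuter_self, add_eq_left,
    show c (I \ I) = 0 by rw [Finset.sdiff_self]; exact hc]
  simp

/-- A family `c_I = φ(u_I)` that is compatible with the differentials. -/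
structure IsMC : Prop where
  empty : c ∅ = 0
  d_eq : ∀ I ≠ Finset.univ, ∀ q hq, L.d _ q hq (c I) = ob n L.toGradedLie c I q hq

/-- By Jacobi, `[h, [c_A, c_B]]` is a sum of two terms exchanged by `A ↔ B`. Doubling both sides
allows the left sum to be paired with its reindexing by complements, after which `gauge_jacobi`
applies summand by summand. -/
theorem sum_gaugeInner {M : Finset (Fin k)} (hIM : Disjoint I M) (hM : c ∅ = 0) (q r : ℤ)
    (hr : r + 1 = gdeg n M) (hq : gdeg n I + 1 + r = q) :
    ∑ A ∈ M.powerset, coef n (I ∪ A) (M \ A) •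
        L.br0 q (coef n I A • L.br0 (gdeg n (I ∪ A)) h (c A)) (c (M \ A)) =
      (coef n I M * (-1 : ℚ) ^ (gdeg n I + 1)) •
        L.br0 q h (ob n L.toGradedLie c M r hr) := by
  refine smul_right_injective _ (two_ne_zero (α := ℚ)) ?_
  dsimp only
  rw [smul_comm (2 : ℚ) (coef n I M * _), ← map_smul (L.br0 q h), two_ob n _ _ hM, map_sum,
    two_smul ℚ (Finset.sum _ _), Finset.smul_sum]
  nth_rewrite 2 [← sum_powerset_sdiff]
  rw [← Finset.sum_add_distrib]
  refine Finset.sum_congr rfl fun A hA => ?_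
  have hA := Finset.mem_powerset.1 hA
  have hu := Finset.union_sdiff_of_subset hA
  have := gauge_jacobi n L.toGradedLie (hIM.mono_right hA)
    (hIM.mono_right (Finset.sdiff_subset (t := A))) Finset.disjoint_sdiff q r (by rw [hu]; exact hr)
    hq h (c A) (c (M \ A))
  rw [hu] at this
  rw [map_smul (L.br0 q h), smul_smul, this, Finset.sdiff_sdiff_eq_self hA]
  simp only [map_smul, LinearMap.smul_apply, smul_smul]

/-- The linearized Maurer–Cartan equation for the gauge direction. With `K = I ⊔ M`, the outer part
gives `[∂h, c_M]` and the inner part gives `±[h, ∂c_M]`; together they are `∂[h, c_M]` by the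
Leibniz rule. -/
theorem sum_gaugeDelta (hI : I.Nonempty) (hc : IsMC n L c) (K : Finset (Fin k)) (q : ℤ)
    (hq : q + 1 = gdeg n K) :
    ∑ J ∈ K.powerset, coef n J (K \ J) • L.br0 q (gaugeDelta n L c I h J) (c (K \ J)) =
      L.d _ q hq (gaugeDelta n L c I h K) := by
  by_cases hIK : I ⊆ K
  swap
  · rw [gaugeDelta_of_not_subset n L c I h hIK, map_zero]
    refine Finset.sum_eq_zero fun J hJ => ?_
    rw [gaugeDelta_of_not_subset n L c I h
      (fun h => hIK (h.trans (Finset.mem_powerset.1 hJ))), map_zero, LinearMap.zero_apply,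
      smul_zero]
  obtain ⟨M, hM, hd⟩ : ∃ M, K = I ∪ M ∧ Disjoint I M :=
    ⟨K \ I, (Finset.union_sdiff_of_subset hIK).symm, Finset.disjoint_sdiff⟩
  subst hM
  have hKI : (I ∪ M) \ I = M := Finset.union_sdiff_cancel_left hd
  -- Even for `K` the full set, `M` is proper, so `∂c_M` is given by the compatibility of `c`.
  have hMu : M ≠ Finset.univ := by
    rintro rfl
    obtain ⟨x, hx⟩ := hI
    exact Finset.disjoint_left.1 hd hx (Finset.mem_univ x)
  have hdeg := gdeg_union n hd
  have h₁ : ∑ J ∈ (I ∪ M).powerset, coef n J ((I ∪ M) \ J) •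
      L.br0 q (gaugeOuter n L I h J) (c ((I ∪ M) \ J)) =
      coef n I M • L.br0 q (L.d _ (gdeg n I) rfl h) (c M) := by
    rw [Finset.sum_eq_single I, gaugeOuter_self, hKI]
    · intro J _ hJ
      rw [gaugeOuter, dif_neg hJ.symm, map_zero, LinearMap.zero_apply, smul_zero]
    · exact fun h => absurd (Finset.mem_powerset.2 hIK) h
  have h₂ : ∑ J ∈ (I ∪ M).powerset, coef n J ((I ∪ M) \ J) •
      L.br0 q (gaugeInner n L c I h J) (c ((I ∪ M) \ J)) =
      ∑ A ∈ M.powerset, coef n (I ∪ A) (M \ A) •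
        L.br0 q (coef n I A • L.br0 (gdeg n (I ∪ A)) h (c A)) (c (M \ A)) := by
    symm
    -- The subsets of `I ∪ M` containing `I` are exactly the `I ∪ A` with `A ⊆ M`; the inner part
    -- vanishes on all others.
    refine Finset.sum_of_injOn (fun A => I ∪ A) ?_ ?_ ?_ ?_
    · intro A hA B hB hAB
      have hA := Finset.mem_powerset.1 (Finset.mem_coe.1 hA)
      have hB := Finset.mem_powerset.1 (Finset.mem_coe.1 hB)
      rw [← Finset.union_sdiff_cancel_left (hd.mono_right hA),
        ← Finset.union_sdiff_cancel_left (hd.mono_right hB)]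
      exact congrArg (· \ I) hAB
    · intro A hA
      exact Finset.mem_coe.2 (Finset.mem_powerset.2
        (Finset.union_subset_union_right (Finset.mem_powerset.1 (Finset.mem_coe.1 hA))))
    · intro J hJ hJ'
      have hIJ : ¬ I ⊆ J := fun hIJ => hJ' ⟨J \ I, Finset.mem_coe.2 (Finset.mem_powerset.2
        (by rw [← hKI]; exact Finset.sdiff_subset_sdiff (Finset.mem_powerset.1 hJ) subset_rfl)),
        Finset.union_sdiff_of_subset hIJ⟩
      rw [gaugeInner, if_neg hIJ, map_zero, LinearMap.zero_apply, smul_zero]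
    · intro A hA
      have hA := Finset.mem_powerset.1 hA
      have e₁ : (I ∪ M) \ (I ∪ A) = M \ A := by
        have := sdiff_sdiff_left (a := I ∪ M) (b := I) (c := A)
        rw [hKI] at this
        exact this.symm
      rw [e₁, gaugeInner, if_pos Finset.subset_union_left,
        Finset.union_sdiff_cancel_left (hd.mono_right hA)]
  have h₃ : L.d _ q hq (gaugeOuter n L I h (I ∪ M)) = 0 := by
    rw [gaugeOuter]
    split_ifs
    · exact L.d_d _ _ _
    · exact map_zero _
  simp only [gaugeDelta, map_add, LinearMap.add_apply, smul_add, Finset.sum_add_distrib]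
  rw [h₁, h₂, h₃, zero_add, gaugeInner, if_pos hIK, map_smul, hKI,
    L.br0_eq (q := gdeg n (I ∪ M)) (by omega), L.leibniz (m' := gdeg n I) (n' := gdeg n M - 1) (by omega) rfl (by omega) hq (by omega)
      (by omega), hc.d_eq M hMu, sum_gaugeInner n L c I h hd hc.empty q (gdeg n M - 1) (by omega)
      (by omega), smul_add, smul_smul, L.br0_eq (by omega), L.br0_eq (by omega)]

/-- The gauge transformation changes the formula for `∂u_K` by a boundary. -/
theorem ob_gauge (hI : I.Nonempty) (hc : IsMC n L c) (K : Finset (Fin k)) (q : ℤ)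
    (hq : q + 1 = gdeg n K) :
    ob n L.toGradedLie (fun K => c K + gaugeDelta n L c I h K) K q hq =
      ob n L.toGradedLie c K q hq + L.d _ q hq (gaugeDelta n L c I h K) := by
  have h0 : gaugeDelta n L c I h ∅ = 0 :=
    gaugeDelta_of_not_subset n L c I h (fun h => hI.ne_empty (Finset.subset_empty.1 h))
  refine smul_right_injective _ (two_ne_zero (α := ℚ)) ?_
  dsimp only
  rw [two_ob n _ _ (by simp [h0, hc.empty]), smul_add, two_ob n _ _ hc.empty, two_smul,
    ← sum_gaugeDelta n L c I h hI hc K q hq]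
  -- The two cross terms agree by graded antisymmetry, which accounts for the factor 2.
  have h₁ : ∑ J ∈ K.powerset, coef n J (K \ J) • L.br0 q (c J) (gaugeDelta n L c I h (K \ J)) =
      ∑ J ∈ K.powerset, coef n J (K \ J) • L.br0 q (gaugeDelta n L c I h J) (c (K \ J)) := by
    rw [← sum_powerset_sdiff]
    refine Finset.sum_congr rfl fun J hJ => ?_
    rw [coef_glie_br0_swap n L.toGradedLie q Finset.disjoint_sdiff,
      Finset.sdiff_sdiff_eq_self (Finset.mem_powerset.1 hJ)]
  -- The quadratic term vanishes: a nonempty `I` cannot lie in both `J` and its complement. This is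
  -- the relation `ε_I² = 0`.
  have h₂ : ∑ J ∈ K.powerset, coef n J (K \ J) •
      L.br0 q (gaugeDelta n L c I h J) (gaugeDelta n L c I h (K \ J)) = 0 := by
    refine Finset.sum_eq_zero fun J _ => ?_
    by_cases hJ : I ⊆ J
    · rw [gaugeDelta_of_not_subset n L c I h (K := K \ J), map_zero, smul_zero]
      obtain ⟨x, hx⟩ := hI
      exact fun h => (Finset.mem_sdiff.1 (h hx)).2 (hJ hx)
    · rw [gaugeDelta_of_not_subset n L c I h hJ, map_zero, LinearMap.zero_apply, smul_zero]
  simp only [map_add, LinearMap.add_apply, smul_add, Finset.sum_add_distrib]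
  rw [h₁, h₂]
  abel

theorem IsMC.gauge (hI : I.Nonempty) (hc : IsMC n L c) :
    IsMC n L (fun K => c K + gaugeDelta n L c I h K) where
  empty := by
    rw [hc.empty, gaugeDelta_of_not_subset n L c I h
      (fun h => hI.ne_empty (Finset.subset_empty.1 h)), add_zero]
  d_eq K hK q hq := by
    rw [ob_gauge n L c I h hI hc, map_add, hc.d_eq K hK]

end Gauge
end Whitehead

/-! ### Quasi-isomorphisms at the level of chains. -/

namespace DGL

theorem cls_eq_cls_iff (L : DGL.{u}) {n : ℤ} (x y : L.cycles n) :
    L.cls x = L.cls y ↔ ∃ z, L.d (n + 1) n rfl z = x.1 - y.1 := by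
  rw [← sub_eq_zero, ← map_sub, cls_eq_zero]
  exact mem_boundaries (n + 1) rfl _

variable {A : DGL.{u}} {B : DGL.{v}}

theorem Hom.mapH_cls (f : Hom A B) {n : ℤ} (x : A.cycles n) :
    f.mapH n (A.cls x) = B.cls ⟨f.map n x.1, f.map_mem_cycles x.2⟩ := rfl

theorem Hom.IsQuasiIso.exists_d_eq {f : Hom A B} (hf : f.IsQuasiIso) {p q : ℤ} (hq : q + 1 = p)
    {x : A.obj q} (hx : x ∈ A.cycles q) {y : B.obj p} (hy : B.d p q hq y = f.map q x) :
    ∃ z, A.d p q hq z = x := by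
  rw [← mem_boundaries]
  refine (A.cls_eq_zero ⟨x, hx⟩).1 ((hf q).1 ?_)
  rw [map_zero, f.mapH_cls, B.cls_eq_zero]
  exact (mem_boundaries p hq _).2 ⟨y, hy⟩

theorem Hom.IsQuasiIso.exists_cycle {f : Hom A B} (hf : f.IsQuasiIso) {p : ℤ}
    {y : B.obj p} (hy : y ∈ B.cycles p) :
    ∃ x ∈ A.cycles p, ∃ z, B.d (p + 1) p rfl z = f.map p x - y := by
  obtain ⟨t, ht⟩ := (hf p).2 (B.cls ⟨y, hy⟩)
  obtain ⟨x, rfl⟩ := A.cls_surjective t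
  exact ⟨x.1, x.2, (B.cls_eq_cls_iff _ _).1 ht⟩

end DGL

namespace Whitehead

open FreeLie

variable {k : ℕ} (n : Fin k → ℤ)

/-! ### Morphisms out of `𝕃(U)` as compatible families. -/

section Morphisms

variable (L : DGL.{u}) (c : ∀ I : Finset (Fin k), L.obj (gdeg n I))

/-- The obstruction at `I` is a cycle as soon as the family is compatible strictly below `I`. No
morphism is available at that stage, but each bracket in `∂u_I` involves only smaller generators, so
`lift_der_brk` applies termwise and `∂² = 0` in `𝕃(U)` concludes. -/
theorem d_ob {I : Finset (Fin k)}
    (hc : ∀ J, J.Nonempty → J ⊂ I → ∀ q hq, L.d _ q hq (c J) = ob n L.toGradedLie c J q hq)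
    (q r : ℤ) (hq : q + 1 = gdeg n I) (hr : r + 1 = q) :
    L.d q r hr (ob n L.toGradedLie c I q hq) = 0 := by
  have key : eval n L.toGradedLie c r (del n q r hr (bdry n I q hq)) =
      L.d q r hr (eval n L.toGradedLie c q (bdry n I q hq)) := by
    unfold bdry
    simp only [map_sum, map_smul]
    refine Finset.sum_congr rfl fun J _ => ?_
    congr 1
    refine lift_der_brk L _ _ _ _ _ (fun q hq => ?_) (fun q hq => ?_) _ _
    · exact (hc _ (left_mem J.2).1 (ssubset_of_mem_splits J.2) q hq).symm
    · exact (hc _ (right_mem J.2).1 (sdiff_ssubset_of_mem_splits J.2) q hq).symm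
  rw [ob, ← key, del_bdry, map_zero]

variable {L c}

/-- The morphism `u_I ↦ c_I` out of `𝕃(U)`. -/
def IsMC.hom (hc : IsMC n L c) : DGL.Hom (lieU n) L where
  map := eval n L.toGradedLie c
  map_bracket h x y := lift_brk _ _ h x y
  map_d h x := lift_der L _ _ (fun I q hq => (hc.d_eq I.1 I.2.2 q hq).symm) x _ h

theorem map_eq_eval (φ : DGL.Hom (lieU n) L) (p : ℤ) (x : LU n p) :
    φ.map p x = eval n L.toGradedLie (fun I => φ.map _ (tot n I)) p x := by
  refine eq_lift L.toGradedLie _ φ.map φ.map_bracket (fun I => ?_) p x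
  refine congrArg (φ.map _) (?_ : mk (.of I rfl) = tot n I.1)
  rw [tot, dif_pos I.2]
  rfl

theorem isMC_of_hom (φ : DGL.Hom (lieU n) L) : IsMC n L (fun I => φ.map _ (tot n I)) where
  empty := by rw [tot_empty]; exact map_zero _
  d_eq I hI q hq := by
    refine (φ.map_d hq (tot n I)).symm.trans ?_
    exact (congrArg _ (del_tot n hI q hq)).trans (map_eq_eval n φ q _)

theorem IsMC.ob_mem_cycles (hc : IsMC n L c) (I : Finset (Fin k)) (q : ℤ)
    (hq : q + 1 = gdeg n I) : ob n L.toGradedLie c I q hq ∈ L.cycles q :=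
  d_ob n L c (fun J _ hJ => hc.d_eq J (fun h => (h ▸ hJ).2 (Finset.subset_univ _))) _ _ _ _

theorem IsMC.map {M : DGL.{v}} (f : DGL.Hom L M) (hc : IsMC n L c) :
    IsMC n M (fun I => f.map _ (c I)) where
  empty := by rw [hc.empty, map_zero]
  d_eq I hI q hq := by
    rw [← f.map_d, hc.d_eq I hI]
    exact map_lift f _ q _

theorem map_ob {M : DGL.{v}} (f : DGL.Hom L M) (I : Finset (Fin k)) (q : ℤ)
    (hq : q + 1 = gdeg n I) : f.map q (ob n L.toGradedLie c I q hq) =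
      ob n M.toGradedLie (fun I => f.map _ (c I)) I q hq :=
  map_lift f _ q _

theorem mem_bracketSet_iff (hk : 2 ≤ k) (a : ∀ i, L.obj (n i - 1)) (z : L.H ((∑ i, n i) - 2)) :
    z ∈ bracketSet L hk n a ↔ ∃ (c : ∀ I : Finset (Fin k), L.obj (gdeg n I)) (hc : IsMC n L c),
      (∀ i, gdeg_single n hk i ▸ c {i} = a i) ∧
        z = L.cls ⟨_, hc.ob_mem_cycles n Finset.univ _ (w_degree n)⟩ := by
  constructor
  · rintro ⟨φ, hφ, rfl⟩
    refine ⟨_, isMC_of_hom n φ, fun i => ?_, ?_⟩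
    · rw [← hφ i]
      refine Eq.trans ?_ (map_eq_eval n φ _ _).symm
      rfl
    · congr 2
      exact map_eq_eval n φ _ _
  · rintro ⟨c, hc, h, rfl⟩
    exact ⟨hc.hom n, h, rfl⟩

end Morphisms

/-! ### Lifting compatible families along a quasi-isomorphism. -/

section Lifting

variable {A : DGL.{u}} {B : DGL.{v}} {f : DGL.Hom A B}

theorem ob_singleton (G : GradedLie.{u}) (c : ∀ I : Finset (Fin k), G.obj (gdeg n I)) (i : Fin k)
    (q : ℤ) (hq : q + 1 = gdeg n {i}) : ob n G c {i} q hq = 0 := by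
  rw [ob_eq_sum]
  refine Finset.sum_eq_zero fun J _ => ?_
  have h₁ := ssubset_of_mem_splits J.2
  have h₂ := (left_mem J.2).1
  rw [Finset.ssubset_singleton_iff] at h₁
  exact absurd h₁ h₂.ne_empty

/-- One step of the lifting argument. -/
theorem exists_lift_step (hf : f.IsQuasiIso) {I : Finset (Fin k)} (hI : I ≠ Finset.univ)
    {c : ∀ I : Finset (Fin k), A.obj (gdeg n I)}
    (hc : ∀ J, J.Nonempty → J ⊂ I → ∀ q hq, A.d _ q hq (c J) = ob n A.toGradedLie c J q hq)
    {ψ : ∀ I : Finset (Fin k), B.obj (gdeg n I)} (hψ : IsMC n B ψ)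
    (hcψ : ∀ J, J.Nonempty → J ⊂ I → f.map _ (c J) = ψ J) :
    ∃ (x : A.obj (gdeg n I)) (h : B.obj (gdeg n I + 1)),
      (∀ q hq, A.d _ q hq x = ob n A.toGradedLie c I q hq) ∧
      B.d _ _ rfl h = f.map _ x - ψ I := by
  have hob : f.map _ (ob n A.toGradedLie c I (gdeg n I - 1) (by omega)) =
      B.d _ _ (by omega) (ψ I) := by
    rw [map_ob, ob_congr n B.toGradedLie hcψ, hψ.d_eq I hI]
  -- Injectivity on homology: the obstruction in `A` is a cycle whose image bounds `ψ I`.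
  obtain ⟨y, hy⟩ := hf.exists_d_eq (by omega) (d_ob n A c hc _ _ _ _) hob.symm
  -- Surjectivity on homology: the cycle `f y - ψ I` need not bound, but subtracting from `y` a
  -- cycle `z` of the same class makes it do so.
  obtain ⟨z, hz, t, ht⟩ := hf.exists_cycle (y := f.map _ y - ψ I) (p := gdeg n I) (by
    rw [DGL.mem_cycles (gdeg n I - 1) (by omega), map_sub, ← f.map_d, hy, hob, sub_self])
  refine ⟨y - z, -t, fun q hq => ?_, ?_⟩
  · obtain rfl : q = gdeg n I - 1 := by omega
    rw [map_sub, hy, (DGL.mem_cycles _ _ z).1 hz, sub_zero]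
  · rw [map_neg, ht, map_sub]
    abel

/-- Induction over families `T` of nonempty proper subsets that are closed under nonempty subsets.
The lift is strict on `T`, at the price of replacing `ψ` by a gauge transform `ψ'`. The relation
between `a i` and `ψ' {i}` is carried along for the singletons not yet treated. -/
theorem exists_partial_lift (hf : f.IsQuasiIso) {a : ∀ i, A.obj (gdeg n {i})}
    (ha : ∀ i q hq, A.d _ q hq (a i) = 0)
    {ψ : ∀ I : Finset (Fin k), B.obj (gdeg n I)} (hψ : IsMC n B ψ)
    (hrel : ∀ i, ∃ y, B.d _ _ rfl y = f.map _ (a i) - ψ {i})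
    (T : Finset (Finset (Fin k))) (hT : ∀ J ∈ T, J.Nonempty ∧ J ≠ Finset.univ)
    (hl : ∀ J ∈ T, ∀ K ⊆ J, K.Nonempty → K ∈ T) :
    ∃ (c : ∀ I : Finset (Fin k), A.obj (gdeg n I)) (ψ' : ∀ I : Finset (Fin k), B.obj (gdeg n I)),
      (∀ J ∈ T, ∀ q hq, A.d _ q hq (c J) = ob n A.toGradedLie c J q hq) ∧
      (∀ i, {i} ∈ T → c {i} = a i) ∧ IsMC n B ψ' ∧ (∀ J ∈ T, f.map _ (c J) = ψ' J) ∧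
      (∀ i, ∃ y, B.d _ _ rfl y = f.map _ (a i) - ψ' {i}) ∧
      ∀ q hq, ∃ y, B.d _ q hq y =
        ob n B.toGradedLie ψ' Finset.univ q hq - ob n B.toGradedLie ψ Finset.univ q hq := by
  induction hm : T.card generalizing T with
  | zero =>
    obtain rfl := Finset.card_eq_zero.1 hm
    exact ⟨0, ψ, by simp, by simp, hψ, by simp, hrel, fun q hq => ⟨0, by simp⟩⟩
  | succ m ih =>
    -- Removing a maximal member keeps `T` closed downwards, and a later gauge transformation at `I`
    -- affects no other member of `T`.
    obtain ⟨I, hI⟩ := T.exists_maximal (Finset.card_pos.1 (by omega))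
    have hmax : ∀ J ∈ T, I ⊆ J → J = I := fun J hJ h => (hI.eq_of_le hJ h).symm
    obtain ⟨c, ψ', h₁, h₂, h₃, h₄, h₅, h₆⟩ := ih (T.erase I)
      (fun J hJ => hT J (Finset.mem_of_mem_erase hJ))
      (fun J hJ K hK hK' => Finset.mem_erase.2 ⟨fun e => (Finset.mem_erase.1 hJ).1
        (hmax J (Finset.mem_of_mem_erase hJ) (e ▸ hK)),
        hl J (Finset.mem_of_mem_erase hJ) K hK hK'⟩)
      (by rw [Finset.card_erase_of_mem hI.1, hm]; rfl)
    obtain ⟨hIn, hIu⟩ := hT I hI.1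
    have hmem : ∀ J, J.Nonempty → J ⊂ I → J ∈ T.erase I := fun J hJ hJI =>
      Finset.mem_erase.2 ⟨hJI.ne, hl I hI.1 J hJI.1 hJ⟩
    obtain ⟨x, h, hx, hh, hxa⟩ : ∃ (x : A.obj (gdeg n I)) (h : B.obj (gdeg n I + 1)),
        (∀ q hq, A.d _ q hq x = ob n A.toGradedLie c I q hq) ∧
        B.d _ _ rfl h = f.map _ x - ψ' I ∧ ∀ i, ∀ e : {i} = I, x = e ▸ a i := by
      -- On a singleton the lift is the prescribed cycle `a i`, and `h` comes from the assumed
      -- homology relation instead of the general step.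
      by_cases hs : ∃ i, {i} = I
      · obtain ⟨i, rfl⟩ := hs
        obtain ⟨h, hh⟩ := h₅ i
        refine ⟨a i, h, fun q hq => ?_, hh, fun j e => ?_⟩
        · rw [ha, ob_singleton]
        · obtain rfl := Finset.singleton_injective e
          rfl
      · obtain ⟨x, h, hx, hh⟩ := exists_lift_step n hf hIu
          (fun J hJ hJI => h₁ J (hmem J hJ hJI)) h₃ (fun J hJ hJI => h₄ J (hmem J hJ hJI))
        exact ⟨x, h, hx, hh, fun i e => absurd ⟨i, e⟩ hs⟩
    have hob : ∀ J ∈ T, ∀ q hq, ob n A.toGradedLie (Function.update c I x) J q hq =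
        ob n A.toGradedLie c J q hq := fun J hJ q hq => ob_congr n _ (fun K _ hK => by
      refine Function.update_of_ne (fun e => ?_) _ _
      subst e
      exact hK.ne (hmax J hJ hK.1).symm) q hq
    refine ⟨Function.update c I x, fun K => ψ' K + gaugeDelta n B ψ' I h K,
      fun J hJ q hq => ?_, fun i hi => ?_, h₃.gauge n B ψ' I h hIn, fun J hJ => ?_,
      fun i => ?_, fun q hq => ?_⟩
    · rw [hob J hJ]
      by_cases e : J = I
      · subst e
        rw [Function.update_self, hx]
      · rw [Function.update_of_ne e, h₁ J (Finset.mem_erase.2 ⟨e, hJ⟩)]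
    · by_cases e : {i} = I
      · subst e
        rw [Function.update_self]
        exact hxa i rfl
      · rw [Function.update_of_ne e, h₂ i (Finset.mem_erase.2 ⟨e, hi⟩)]
    · by_cases e : J = I
      · subst e
        rw [Function.update_self]
        dsimp only
        rw [gaugeDelta_self n B ψ' J h h₃.empty, hh]
        abel
      · dsimp only
        rw [Function.update_of_ne e, h₄ J (Finset.mem_erase.2 ⟨e, hJ⟩),
          gaugeDelta_of_not_subset n B ψ' I h (fun hIJ => e (hmax J hJ hIJ)), add_zero]
    · obtain ⟨y, hy⟩ := h₅ i
      by_cases e : I ⊆ {i}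
      · obtain rfl := (Finset.Nonempty.subset_singleton_iff hIn).1 e
        refine ⟨y - h, ?_⟩
        dsimp only
        rw [gaugeDelta_self n B ψ' {i} h h₃.empty, map_sub, hy]
        abel
      · exact ⟨y, by dsimp only; rw [hy, gaugeDelta_of_not_subset n B ψ' I h e, add_zero]⟩
    · obtain ⟨y, hy⟩ := h₆ q hq
      -- No equation is imposed on the component at the full set; its gauge variation is the chain
      -- bounding the change of the top obstruction.
      refine ⟨y + gaugeDelta n B ψ' I h Finset.univ, ?_⟩
      rw [ob_gauge n B ψ' I h hIn h₃, map_add, hy]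
      abel

/-- Up to a gauge transformation, a compatible family lifts along a quasi-isomorphism, with
prescribed cycles as lifts of the `ψ_i`. -/
theorem exists_lift (hk : 2 ≤ k) (hf : f.IsQuasiIso) {a : ∀ i, A.obj (gdeg n {i})}
    (ha : ∀ i q hq, A.d _ q hq (a i) = 0)
    {ψ : ∀ I : Finset (Fin k), B.obj (gdeg n I)} (hψ : IsMC n B ψ)
    (hrel : ∀ i, ∃ y, B.d _ _ rfl y = f.map _ (a i) - ψ {i}) :
    ∃ c : ∀ I : Finset (Fin k), A.obj (gdeg n I), IsMC n A c ∧ (∀ i, c {i} = a i) ∧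
      ∀ q hq, ∃ y, B.d _ q hq y = f.map _ (ob n A.toGradedLie c Finset.univ q hq) -
        ob n B.toGradedLie ψ Finset.univ q hq := by
  classical
  obtain ⟨c, ψ', h₁, h₂, h₃, h₄, -, h₆⟩ := exists_partial_lift n hf ha hψ hrel
    {J | J.Nonempty ∧ J ≠ Finset.univ} (fun J hJ => (Finset.mem_filter.1 hJ).2)
    (fun J hJ K hK hK' => Finset.mem_filter.2 ⟨Finset.mem_univ _, hK', fun e => by
      subst e
      exact (Finset.mem_filter.1 hJ).2.2 (Finset.univ_subset_iff.1 hK)⟩)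
  simp only [Finset.mem_filter, Finset.mem_univ, true_and] at h₁ h₂ h₄
  have hob : ∀ J q hq, ob n A.toGradedLie (Function.update c ∅ 0) J q hq =
      ob n A.toGradedLie c J q hq := fun J q hq =>
    -- The partial lift says nothing at `∅`. Resetting that value to `0`, as `IsMC` demands, leaves
    -- every obstruction unchanged.
    ob_congr n _ (fun K hK _ => Function.update_of_ne hK.ne_empty _ _) q hq
  refine ⟨Function.update c ∅ 0, ⟨Function.update_self _ _ _, fun I hI q hq => ?_⟩,
    fun i => ?_, fun q hq => ?_⟩
  · rw [hob]
    rcases I.eq_empty_or_nonempty with rfl | hI'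
    · rw [Function.update_self, map_zero, ob, bdry_empty, map_zero]
    · rw [Function.update_of_ne hI'.ne_empty, h₁ I ⟨hI', hI⟩]
  · rw [Function.update_of_ne (Finset.singleton_ne_empty i), h₂ i (single hk i).2]
  · obtain ⟨y, hy⟩ := h₆ q hq
    refine ⟨y, ?_⟩
    rw [hy, hob, map_ob, ob_congr n B.toGradedLie (fun J hJ hJ' => h₄ J ⟨hJ, hJ'.ne⟩)]

end Lifting

end Whitehead

/-! ### Homology as a DGL with zero differential. -/

namespace DGL

/-- The identity morphism. -/
def Hom.id (A : DGL.{u}) : Hom A A where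
  map _ := LinearMap.id
  map_bracket _ _ _ := rfl
  map_d _ _ := rfl

theorem Hom.mapH_id (A : DGL.{u}) (n : ℤ) (x : A.H n) : (Hom.id A).mapH n x = x := by
  obtain ⟨x, rfl⟩ := A.cls_surjective x
  rfl

theorem Hom.isQuasiIso_id (A : DGL.{u}) : (Hom.id A).IsQuasiIso := fun n => by
  rw [show ((Hom.id A).mapH n : A.H n → A.H n) = _root_.id from funext (Hom.mapH_id A n)]
  exact Function.bijective_id

/-- The morphism induced on homology, as a morphism of DGLs with zero differential. -/
def Hom.homology {A : DGL.{u}} {B : DGL.{v}} (f : Hom A B) :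
    Hom A.homologyDGL B.homologyDGL where
  map := f.mapH
  map_bracket h x y := by
    obtain ⟨x, rfl⟩ := A.cls_surjective x
    obtain ⟨y, rfl⟩ := A.cls_surjective y
    refine congrArg B.cls (Subtype.ext ?_)
    exact f.map_bracket h _ _
  map_d _ _ := map_zero _

theorem homologyDGL_mem_cycles (L : DGL.{u}) {n : ℤ} (x : L.homologyDGL.obj n) :
    x ∈ L.homologyDGL.cycles n :=
  (mem_cycles (n - 1) (by omega) x).2 rfl

/-- The identification of `H_*(L)` with its own homology. -/
noncomputable def homologySelf (L : DGL.{u}) (n : ℤ) :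
    L.homologyDGL.obj n ≃ₗ[ℚ] L.homologyDGL.homologyDGL.obj n :=
  LinearEquiv.ofBijective (M₂ := L.homologyDGL.H n)
    (L.homologyDGL.cls ∘ₗ LinearMap.id.codRestrict _ L.homologyDGL_mem_cycles) (by
      constructor
      · rw [injective_iff_map_eq_zero]
        intro x hx
        obtain ⟨y, hy⟩ := (mem_boundaries (n + 1) rfl _).1 ((L.homologyDGL.cls_eq_zero _).1 hx)
        exact hy.symm
      · intro z
        obtain ⟨x, rfl⟩ := L.homologyDGL.cls_surjective z
        exact ⟨x.1, rfl⟩)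

theorem homologySelf_bracket (L : DGL.{u}) {m n p : ℤ} (h : m + n = p)
    (x : L.homologyDGL.obj m) (y : L.homologyDGL.obj n) :
    L.homologySelf p (L.homologyDGL.bracket h x y) =
      L.homologyDGL.homologyDGL.bracket h (L.homologySelf m x) (L.homologySelf n y) := rfl

end DGL

/-! ### Invariance of bracket sets under zig-zags. -/

namespace Whitehead

open FreeLie

variable {k : ℕ} {n : Fin k → ℤ}

/-- The degrees `gdeg n {i}` and `n i - 1` are equal but not definitionally so; the representatives
`a i` have to be moved between them. -/
theorem exists_d_eq_transport {A : DGL.{u}} {B : DGL.{v}} (f : DGL.Hom A B) {p q : ℤ} (e : p = q)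
    {x : A.obj q} {y : B.obj p} (h : ∃ z, B.d (q + 1) q rfl z = f.map q x - e ▸ y) :
    ∃ z, B.d (p + 1) p rfl z = f.map p (e.symm ▸ x) - y := by
  subst e
  exact h

theorem d_transport {A : DGL.{u}} {p q : ℤ} (e : p = q) {x : A.obj q} (hx : x ∈ A.cycles q)
    (r : ℤ) (hr : r + 1 = p) : A.d p r hr (e.symm ▸ x) = 0 := by
  subst e
  exact (DGL.mem_cycles r hr x).1 hx

theorem exists_mem_bracketSet {A : DGL.{u}} {B : DGL.{v}} {f : DGL.Hom A B} (hf : f.IsQuasiIso)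
    (hk : 2 ≤ k) (a : ∀ i, A.cycles (n i - 1)) (b : ∀ i, B.cycles (n i - 1))
    (hab : ∀ i, B.cls (b i) = f.mapH _ (A.cls (a i))) {z : B.H ((∑ i, n i) - 2)}
    (hz : z ∈ bracketSet B hk n (fun i => (b i).1)) :
    ∃ t ∈ bracketSet A hk n (fun i => (a i).1), f.mapH _ t = z := by
  rw [mem_bracketSet_iff] at hz
  obtain ⟨ψ, hψ, hb, rfl⟩ := hz
  obtain ⟨c, hc, hca, hcw⟩ := exists_lift n hk hf
    (a := fun i => (gdeg_single n hk i).symm ▸ (a i).1)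
    (fun i q hq => d_transport (gdeg_single n hk i) (a i).2 q hq) hψ
    (fun i => exists_d_eq_transport f (gdeg_single n hk i) (by
      rw [hb i]
      exact (DGL.cls_eq_cls_iff B ⟨_, f.map_mem_cycles (a i).2⟩ (b i)).1 (hab i).symm))
  refine ⟨_, (mem_bracketSet_iff n hk _ _).2 ⟨c, hc, fun i => ?_, rfl⟩, ?_⟩
  · rw [hca i]
    generalize (a i).1 = y
    generalize_proofs h₁ h₂
    revert h₁ h₂
    generalize n i - 1 = p at *
    rintro h rfl
    rfl
  · refine (DGL.cls_eq_cls_iff B _ _).2 ((DGL.mem_boundaries _ rfl _).1 ?_)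
    exact (DGL.mem_boundaries _ (w_degree n) _).2 (hcw _ _)

theorem map_mem_bracketSet {A : DGL.{u}} {B : DGL.{v}} (f : DGL.Hom A B) (hk : 2 ≤ k)
    {a : ∀ i, A.obj (n i - 1)} {z : A.H ((∑ i, n i) - 2)} (hz : z ∈ bracketSet A hk n a) :
    f.mapH _ z ∈ bracketSet B hk n (fun i => f.map _ (a i)) := by
  obtain ⟨φ, hφ, rfl⟩ := hz
  exact ⟨⟨fun p => f.map p ∘ₗ φ.map p, fun h x y => by simp [φ.map_bracket, f.map_bracket],
    fun h x => by simp [φ.map_d, f.map_d]⟩, fun i => congrArg (f.map _) (hφ i), rfl⟩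

/-- Quasi-isomorphisms preserve Whitehead bracket sets, for any choice of representatives. -/
theorem bracketSet_eq_image {A : DGL.{u}} {B : DGL.{v}} {f : DGL.Hom A B} (hf : f.IsQuasiIso)
    (hk : 2 ≤ k) (a : ∀ i, A.cycles (n i - 1)) (b : ∀ i, B.cycles (n i - 1))
    (hab : ∀ i, B.cls (b i) = f.mapH _ (A.cls (a i))) :
    bracketSet B hk n (fun i => (b i).1) =
      f.mapH _ '' bracketSet A hk n (fun i => (a i).1) := by
  refine Set.Subset.antisymm (fun z hz => exists_mem_bracketSet hf hk a b hab hz) ?_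
  rintro _ ⟨t, ht, rfl⟩
  -- Lifting along the identity of `B` replaces the representatives `f(a_i)` by the homologous `b_i`
  -- without changing the class.
  obtain ⟨z, hz, hzt⟩ := exists_mem_bracketSet (DGL.Hom.isQuasiIso_id B) hk b
    (fun i => ⟨_, f.map_mem_cycles (a i).2⟩)
    (fun i => by rw [DGL.Hom.mapH_id, hab i, f.mapH_cls]) (map_mem_bracketSet f hk ht)
  rw [DGL.Hom.mapH_id] at hzt
  rwa [← hzt]

/-- A zig-zag of quasi-isomorphisms induces an isomorphism of homology Lie algebras that preserves
Whitehead bracket sets. -/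
theorem exists_homology_iso {A B : DGL.{u}}
    (h : Relation.EqvGen (fun A B : DGL.{u} => ∃ f : DGL.Hom A B, f.IsQuasiIso) A B) :
    ∃ θ : DGL.Hom A.homologyDGL B.homologyDGL, (∀ p, Function.Bijective (θ.map p)) ∧
      ∀ (k : ℕ) (hk : 2 ≤ k) (n : Fin k → ℤ) (a : ∀ i, A.cycles (n i - 1))
        (b : ∀ i, B.cycles (n i - 1)), (∀ i, B.cls (b i) = θ.map _ (A.cls (a i))) →
        bracketSet B hk n (fun i => (b i).1) =
          θ.map _ '' bracketSet A hk n (fun i => (a i).1) := by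
  induction h with
  | rel A B h =>
    obtain ⟨f, hf⟩ := h
    exact ⟨f.homology, hf, fun k hk n a b hab => bracketSet_eq_image hf hk a b hab⟩
  | refl A =>
    exact ⟨(DGL.Hom.id A).homology, DGL.Hom.isQuasiIso_id A,
      fun k hk n a b hab => bracketSet_eq_image (DGL.Hom.isQuasiIso_id A) hk a b hab⟩
  | symm A B _ ih =>
    obtain ⟨θ, hθ, H⟩ := ih
    let e : ∀ p, A.homologyDGL.obj p ≃ₗ[ℚ] B.homologyDGL.obj p :=
      fun p => LinearEquiv.ofBijective (θ.map p) (hθ p)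
    have he : ∀ p x, θ.map p ((e p).symm x) = x := fun p x => (e p).apply_symm_apply x
    refine ⟨⟨fun p => (e p).symm, fun {m n p} h x y => (hθ p).1 ?_, fun _ _ => map_zero _⟩,
      fun p => (e p).symm.bijective, fun k hk n a b hab => ?_⟩
    · rw [θ.map_bracket]
      exact (he _ _).trans (by rw [LinearEquiv.coe_coe, LinearEquiv.coe_coe, he, he])
    · rw [H k hk n b a (fun i => by rw [hab i]; exact (he _ _).symm)]
      exact ((e _).toEquiv.symm_image_image _).symm
  | trans A B C _ _ ih ih' =>
    obtain ⟨θ, hθ, H⟩ := ih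
    obtain ⟨θ', hθ', H'⟩ := ih'
    refine ⟨⟨fun p => θ'.map p ∘ₗ θ.map p,
      fun h x y => by simp [θ.map_bracket, θ'.map_bracket], fun h x => map_zero _⟩,
      fun p => (hθ' p).comp (hθ p), fun k hk n a c hac => ?_⟩
    -- Any representatives in the middle DGL will do, since both induction hypotheses hold for every
    -- choice.
    choose b hb using fun i => B.cls_surjective (θ.map _ (A.cls (a i)))
    rw [H' k hk n b c (fun i => by rw [hac i, hb i]; rfl), H k hk n a b hb]
    exact Set.image_image _ _ _

/-- With zero differential, a compatible family has vanishing obstruction at every proper `I`.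
Keeping only its singleton components preserves this at two-element sets; in all other sizes every
splitting has a block that is not a singleton. -/
theorem zero_mem_bracketSet {L : DGL.{u}} (hL : ∀ p q h x, L.d p q h x = 0) (hk : 2 ≤ k)
    (hk3 : 3 ≤ k) {a : ∀ i, L.obj (n i - 1)} (hne : (bracketSet L hk n a).Nonempty) :
    0 ∈ bracketSet L hk n a := by
  obtain ⟨z, hz⟩ := hne
  rw [mem_bracketSet_iff] at hz ⊢
  obtain ⟨c, hc, hca, -⟩ := hz
  let c' : ∀ I : Finset (Fin k), L.obj (gdeg n I) := fun I => if I.card = 1 then c I else 0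
  have hob : ∀ I q hq, ob n L.toGradedLie c' I q hq = 0 := by
    intro I q hq
    by_cases hI : I.card = 2
    · rw [ob_congr n L.toGradedLie (c' := c), ← hc.d_eq I, hL]
      -- Here `3 ≤ k` enters: the full set does not have two elements, so the compatibility of `c`
      -- applies to `I`.
      · rintro rfl
        rw [Finset.card_univ, Fintype.card_fin] at hI
        omega
      · intro J hJ hJI
        have := Finset.card_lt_card hJI
        have := hJ.card_pos
        exact if_pos (by omega)
    · rw [ob_eq_sum]
      refine Finset.sum_eq_zero fun J _ => ?_
      have := Finset.card_sdiff_add_card_eq_card (subset_of_mem J.2)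
      by_cases h : J.1.card = 1
      · rw [show c' (I \ J.1) = 0 from if_neg (by omega), map_zero, smul_zero]
      · rw [show c' J.1 = 0 from if_neg h, map_zero, LinearMap.zero_apply, smul_zero]
  have hc' : IsMC n L c' := ⟨if_neg (by simp), fun I _ q hq => by rw [hL, hob]⟩
  refine ⟨c', hc', fun i => ?_, ?_⟩
  · rw [← hca i, show c' {i} = c {i} from if_pos (Finset.card_singleton i)]
  · rw [← map_zero L.cls]
    congr 1
    exact Subtype.ext (hob _ _ _).symm

end Whitehead

/-! ### Obstructions to formality. -/

theorem theorem1p7 (L : DGL.{u}) (k : ℕ) (hk : 2 ≤ k) (n : Fin k → ℤ)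
    (x : ∀ i, L.H (n i - 1))
    (a : ∀ i, L.cycles (n i - 1)) (ha : ∀ i, L.cls (a i) = x i)
    (hne : (Whitehead.bracketSet L hk n (fun i => (a i).1)).Nonempty)
    (h : (3 ≤ k ∧ 0 ∉ Whitehead.bracketSet L hk n (fun i => (a i).1)) ∨
      ¬ Nonempty (Whitehead.bracketSet L hk n (fun i => (a i).1) ≃
        Whitehead.bracketSet L.homologyDGL hk n x)) :
    ¬ L.IsFormal := by
  intro hformal
  obtain ⟨θ, hθ, H⟩ := Whitehead.exists_homology_iso hformal
  -- Formality gives `θ : H(L) → H(H(L))`, which need not be the canonical identification. Their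
  -- discrepancy `α` is an automorphism of `H`, so the bracket set of `L` is matched with that of
  -- the `α(x_i)`, and a second comparison along `α` is needed to return to the `x_i`.
  let α : DGL.Hom L.homologyDGL L.homologyDGL :=
    { map := fun p => (L.homologySelf p).symm.toLinearMap ∘ₗ θ.map p
      map_bracket := fun {m n p} h x y => by
        refine (L.homologySelf p).injective ?_
        rw [DGL.homologySelf_bracket]
        simp only [LinearMap.comp_apply, LinearEquiv.coe_coe, LinearEquiv.apply_symm_apply]
        exact θ.map_bracket h x y
      map_d := fun _ _ => map_zero _ }
  have hα : ∀ p y, L.homologySelf p (α.map p y) = θ.map p y :=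
    fun p y => (L.homologySelf p).apply_symm_apply _
  have hqi : α.IsQuasiIso := fun p => by
    -- Under `homologySelf`, the map induced by `α` on homology is `α` itself, hence bijective
    -- because `θ` is.
    refine (Function.Bijective.of_comp_iff (α.mapH p) (L.homologySelf p).bijective).1 ?_
    have : L.homologySelf p ∘ α.map p = θ.map p := funext (hα p)
    exact this ▸ hθ p
  have h₁ := H k hk n a (fun i => ⟨α.map _ (x i), L.homologyDGL_mem_cycles _⟩)
    (fun i => by rw [ha i]; exact hα _ _)
  have h₂ := Whitehead.bracketSet_eq_image hqi hk
    (fun i => ⟨x i, L.homologyDGL_mem_cycles _⟩)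
    (fun i => ⟨α.map _ (x i), L.homologyDGL_mem_cycles _⟩) (fun i => rfl)
  dsimp only at h₁ h₂
  rcases h with ⟨hk3, h0⟩ | h
  · have h0' := Whitehead.zero_mem_bracketSet (L := L.homologyDGL) (fun _ _ _ _ => rfl) hk hk3
      (h₁ ▸ hne.image _)
    rw [h₁] at h0'
    obtain ⟨t, ht, ht0⟩ := h0'
    obtain rfl : t = 0 := (hθ _).1 (ht0.trans (map_zero _).symm)
    exact h0 ht
  · exact h ⟨(Equiv.Set.image _ _ (hθ _).1).trans
      ((Equiv.setCongr (h₁.symm.trans h₂)).trans (Equiv.Set.image _ _ (hqi _).1).symm)⟩
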